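/- Let $(X,\mathcal B)$ be a standard Borel space with a probability measure $\mu$, and let $\alpha$ be an at most countable partition of $X$ into measurable sets of positive measure. Let $\theta:X\to X$ preserve $\mu$ and be such that $(X,\theta,\mu,\alpha)$ is a Gibbs–Markov map with full branches. That is: for each $a\in\alpha$ the map $\theta|_a:a\to\theta(a)$ is invertible, bimeasurable and non-singular, and $\theta(a)=X$ mod $\mu$; the cylinders $[w]=[w_1\dots w_n]=\bigcap_{k=1}^{n}\theta^{-(k-1)}(w_k)$ ($w_k\in\alpha$, $n\ge 1$) generate $\mathcal B$ up to null sets; and there are $C>0$ and $r\in(0,1)$ such that, for every finite word $w=(w_1\dots w_n)$ in the alphabet $\alpha$ and a.e. $x,y\in X$, $$|\log\varphi_w(x)-\log\varphi_w(y)|\le C\,d_r(x,y),\qquad \varphi_w=\frac{d(\mu\circ\tau_w)}{d\mu}.$$ Here $\tau_w$ is the inverse of $\theta^n|_{[w]}$, and $d_r(x,y)=r^{\min\{k\ge 0\,:\,\theta^kx,\ \theta^ky\text{ lie in different elements of }\alpha\}}$ (which is $0$ if there is no such $k$). Let $\mathcal G=(\mathbf V,\mathbf E)$ be a directed graph with an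 at most countable, non-empty vertex set, $\mathbf E\subset\mathbf V\times\mathbf V$. For each $x\in X$ let $\kappa_x:\mathbf V\to\mathbf V$ be a bijection with $(g,\kappa_x(g))\in\mathbf E$ for all $g\in\mathbf V$ and with $\kappa_x=\kappa_y$ whenever $x,y$ lie in the same element of $\alpha$. Let $T:X\times\mathbf V\to X\times\mathbf V$, $T(x,g)=(\theta x,\kappa_x(g))$, and let $m=\mu\otimes(\text{counting measure on }\mathbf V)$. Suppose that - $T$ is topologically transitive: for all $a,b\in\alpha$ and $g,h\in\mathbf V$ there is $n\ge1$ with $m\big(T^n(a\times\{g\})\cap(b\times\{h\})\big)>0$; - for some $n\ge1$, $T^n$ has uniform loops: there is a finite $\mathcal J\subset X$ such that for every $v\in\mathbf V$ there is $x\in\mathcal J$ with $T^n(x,v)\in X\times\{v\}$. For measurable $f$ on $X\times\mathbf V$ (functions equal $m$-a.e. being identified) and $p\in\{1,\infty\}$ put $\llbracket f\rrbracket_p=\big(\sum_{g\in\mathbf V}\|f(\cdot,g)\|_{L^p(\mu)}^2\big)^{1/2}$. Let $\mathcal H_\infty$ be the Banach space of complex-valued $f$ with $\llbracket f\rrbracket_\infty<\infty$.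 Then there is a unique bounded operator $\widehat T:\mathcal H_\infty\to\mathcal H_\infty$ with $\int \widehat T(f)\,h\,dm=\int f\,(h\circ T)\,dm$ for all $f\in\mathcal H_\infty$ and $h\in L^1(m)$ (the transfer operator of $T$), and the following assertions are equivalent. 1. $\mathcal G$ is $\mu$-amenable, i.e. with $p(u,v)=\mu\{x:\kappa_x(u)=v\}$ and $\partial^\epsilon K=\{v\in K:\exists\, u\notin K,\ (v,u)\in\mathbf E,\ p(v,u)>\epsilon\}$, $$\lim_{\epsilon\to0^+}\inf\Big\{\frac{|\partial^\epsilon K|}{|K|}: K\subset\mathbf V\text{ finite and non-empty}\Big\}=0.$$ 2. The spectral radius of $\widehat T:\mathcal H_\infty\to\mathcal H_\infty$ is equal to $1$. 3. For each $\epsilon>0$ there is a finite non-empty $A\subset\mathbf V$ with $\int|\widehat T(\mathbf 1_{X\times A})-\mathbf 1_{X\times A}|\,dm\le\epsilon\cdot\#A$. 4. For each $\epsilon>0$ there is a finite non-empty $A\subset\mathbf V$ with $\llbracket\widehat T(\mathbf 1_{X\times A})-\mathbf 1_{X\times A}\rrbracket_1\le\epsilon\,\llbracket\mathbf 1_{X\times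 A}\rrbracket_1$. -/

import Mathlib

open MeasureTheory Filter Topology
open scoped ENNReal

noncomputable section

namespace GraphExtension

universe u v w

section MarkovMaps

variable {X : Type u} {ι : Type v}

/-- The cylinder `[w₀ … wₙ₋₁]`: the points `x` with `θᵏ x ∈ α (wₖ)` for all `k < n`. -/
def cylinder (θ : X → X) (α : ι → Set X) {n : ℕ} (w : Fin n → ι) : Set X :=
  {x | ∀ k : Fin n, θ^[k] x ∈ α (w k)}

/-- `(X, θ, μ, α)` is a Markov map, where the partition `α` of `X` is given as an indexed family. -/
structure IsMarkovMap [MeasurableSpace X] (θ : X → X) (μ : Measure X) (α : ι → Set X) : Prop where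
  measurableSet_atom : ∀ i, MeasurableSet (α i)
  measure_atom_pos : ∀ i, 0 < μ (α i)
  pairwise_disjoint : Pairwise fun i j => Disjoint (α i) (α j)
  iUnion_eq : ⋃ i, α i = Set.univ
  /-- `θ : a → θ(a)` is invertible and bimeasurable. -/
  bimeasurable : ∀ i, MeasurableEmbedding ((α i).domRestrict θ)
  /-- `θ : a → θ(a)` is non-singular. -/
  nonsingular : ∀ i, ∀ B ⊆ α i, MeasurableSet B → (μ (θ '' B) = 0 ↔ μ B = 0)
  /-- The Markov property. -/
  markov : ∀ i j, μ (α i ∩ θ '' α j) = 0 ∨ μ (α i ∩ (θ '' α j)ᶜ) = 0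
  /-- The cylinders generate the `σ`-algebra up to sets of measure zero. -/
  generating : ∀ B, MeasurableSet B → ∃ B',
    MeasurableSet[MeasurableSpace.generateFrom
      {C | ∃ n : ℕ, 0 < n ∧ ∃ w : Fin n → ι, C = cylinder θ α w}] B' ∧ B =ᵐ[μ] B'

/-- `φ_w = d(μ ∘ τ_w) / dμ`, where `τ_w` is the inverse of `θⁿ : [w] → θⁿ([w])`. Here `μ ∘ τ_w` is
the measure `B ↦ μ(τ_w(B ∩ θⁿ[w])) = μ([w] ∩ θ⁻ⁿ(B))`. -/
def branchDensity [MeasurableSpace X] (θ : X → X) (μ : Measure X) (α : ι → Set X) {n : ℕ}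
    (w : Fin n → ι) : X → ℝ≥0∞ :=
  ((μ.restrict (cylinder θ α w)).map θ^[n]).rnDeriv μ

/-- The times `n` at which the itineraries of `x` and `y` with respect to `α` differ. -/
def differingTimes (θ : X → X) (α : ι → Set X) (x y : X) : Set ℕ :=
  {n | ¬ ∃ i, θ^[n] x ∈ α i ∧ θ^[n] y ∈ α i}

open Classical in
/-- The symbolic metric `d_r(x, y) = r ^ min {n : xₙ ≠ yₙ}`, which is `0` if there is no such `n`. -/
def symbolicDist (θ : X → X) (α : ι → Set X) (r : ℝ) (x y : X) : ℝ :=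
  if (differingTimes θ α x y).Nonempty then r ^ sInf (differingTimes θ α x y) else 0

/-- `(X, θ, μ, α)` is a Gibbs–Markov map with full branches. Since the branches are full, all finite
words in the alphabet are admissible (mod `μ`). -/
structure IsFullGibbsMarkov [MeasurableSpace X] (θ : X → X) (μ : Measure X) (α : ι → Set X) : Prop
    extends IsMarkovMap θ μ α where
  full_branches : ∀ i, μ (θ '' α i)ᶜ = 0
  gibbs : ∃ C : ℝ, 0 < C ∧ ∃ r : ℝ, 0 < r ∧ r < 1 ∧
    ∀ (n : ℕ) (w : Fin n → ι), ∀ᵐ x ∂μ, ∀ᵐ y ∂μ,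
      |Real.log (branchDensity θ μ α w x).toReal - Real.log (branchDensity θ μ α w y).toReal|
        ≤ C * symbolicDist θ α r x y

end MarkovMaps

section Extensions

variable {X : Type u} {ι : Type v} {V : Type w}

/-- `κ` is a nearest neighbour cocycle: each `κ_x` is a bijection of the vertex set, moves every
vertex along an edge, and depends only on the partition element that contains `x`. -/
structure IsNearestNeighbourCocycle (G : Digraph V) (α : ι → Set X)
    (κ : X → Equiv.Perm V) : Prop where
  adj : ∀ x g, G.Adj g (κ x g)
  const_on_atoms : ∀ i, ∀ x ∈ α i, ∀ y ∈ α i, κ x = κ y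

/-- The graph extension `T(x, g) = (θ x, κ_x(g))`. -/
def extensionMap (θ : X → X) (κ : X → Equiv.Perm V) (p : X × V) : X × V :=
  (θ p.1, κ p.1 p.2)

/-- Topological transitivity of a map of `X × V` as a Markov map with respect to the product of `μ`
and the counting measure and the partition into the sets `a × {g}`, `a ∈ α`, `g ∈ V`. -/
def IsTopologicallyTransitive [MeasurableSpace X] [MeasurableSpace V] (μ : Measure X)
    (α : ι → Set X) (S : X × V → X × V) : Prop :=
  ∀ (i j : ι) (g h : V), ∃ n : ℕ, 0 < n ∧
    0 < (μ.prod Measure.count) (S^[n] '' (α i ×ˢ {g}) ∩ (α j ×ˢ {h}))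

/-- Uniform loops for a map of `X × V`: there is a finite set `J ⊆ X` such that every vertex `v` is
fixed by the second coordinate of the map over some `x ∈ J`. -/
def HasUniformLoops (S : X × V → X × V) : Prop :=
  ∃ J : Finset X, ∀ v : V, ∃ x ∈ J, (S (x, v)).2 = v

/-- The `ε`-boundary of `K` in the graph `G` with weight `p`. -/
def epsBoundary (G : Digraph V) (p : V → V → ℝ) (ε : ℝ) (K : Finset V) : Set V :=
  {v | v ∈ K ∧ ∃ u, G.Adj v u ∧ u ∉ K ∧ ε < p v u}

/-- `p`-amenability of the weighted graph `G`; the infimum is over finite non-empty sets. -/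
def IsWeightAmenable (G : Digraph V) (p : V → V → ℝ) : Prop :=
  Tendsto (fun ε : ℝ => ⨅ K : {K : Finset V // K.Nonempty},
    ((epsBoundary G p ε K.1).ncard : ℝ) / (K.1.card : ℝ)) (𝓝[>] 0) (𝓝 0)

/-- The canonical weight `p(u, v) = μ {x : κ_x(u) = v}`. -/
def canonicalWeight [MeasurableSpace X] (μ : Measure X) (κ : X → Equiv.Perm V) (u v : V) : ℝ :=
  μ.real {x | κ x u = v}

/-- `μ`-amenability. -/
def IsMuAmenable [MeasurableSpace X] (G : Digraph V) (μ : Measure X) (κ : X → Equiv.Perm V) : Prop :=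
  IsWeightAmenable G (canonicalWeight μ κ)

end Extensions

section TransferOperator

variable {X : Type u} [MeasurableSpace X]

/-- The Banach space `ℋ_∞` of (classes of) functions `f` on `X × V` whose norm
`(∑_g ‖f(·, g)‖_∞ ²)^{1/2}` is finite, as the `ℓ²`-sum over `g ∈ V` of copies of `L^∞(μ)`.
The functions are complex valued, as the spectrum of an operator refers to complex scalars. -/
abbrev HInfty (μ : Measure X) (V : Type w) : Type (max u w) :=
  lp (fun _ : V => Lp ℂ ∞ μ) 2

variable {μ : Measure X} {V : Type w}

/-- An element of `ℋ_∞` as a function on `X × V`. -/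
def toFun (f : HInfty μ V) (p : X × V) : ℂ := f p.2 p.1

/-- The norm `⟦f⟧₁ = (∑_g ‖f(·, g)‖₁ ²)^{1/2}`. -/
def norm1 (f : HInfty μ V) : ℝ≥0∞ :=
  (∑' g : V, eLpNorm (f g) 1 μ ^ 2) ^ (1 / 2 : ℝ)

open Classical in
/-- The indicator function `1_{X × A}` of a finite set `A` of vertices, as an element of `ℋ_∞`. -/
def fiberIndicator (μ : Measure X) [IsFiniteMeasure μ] (A : Finset V) : HInfty μ V :=
  ∑ g ∈ A, lp.single 2 g (Lp.const ∞ μ (1 : ℂ))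

/-- `L` is the transfer operator of the map `S` of `X × V` on `ℋ_∞`, i.e. it is dual to the Koopman
operator `h ↦ h ∘ S` with respect to the product `m` of `μ` and the counting measure:
`∫ (L f) h dm = ∫ f (h ∘ S) dm`. Elements of `ℋ_∞` are bounded, but need not be integrable,
hence the test functions `h` range over all integrable functions. -/
def IsTransferOperator [MeasurableSpace V] (S : X × V → X × V)
    (L : HInfty μ V →L[ℂ] HInfty μ V) : Prop :=
  ∀ (f : HInfty μ V) (h : X × V → ℂ), Integrable h (μ.prod Measure.count) →
    ∫ p, toFun (L f) p * h p ∂(μ.prod Measure.count) =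
      ∫ p, toFun f p * h (S p) ∂(μ.prod Measure.count)

end TransferOperator

end GraphExtension

end

noncomputable section

set_option linter.unusedSectionVars false

namespace GraphExtension

/-! ### Cylinders, the symbolic metric, and the vertex permutation of a word -/

section Words

variable {X ι V : Type*} {θ : X → X} {α : ι → Set X}

/-! All four conditions are compared with a single one, `HasFolnerSets`: there are finite vertex
sets `A` such that the part of `X × A` that leaves `X × A` in one step has mass at most `ε · #A`.

For amenability the comparison is a counting argument, since finitely many atoms carry almost all of
`μ`. For conditions 3 and 4, duality shows that on each fiber the transfer operator sends the
indicator of `X × A` to a density with values in `[0, 1]`. The `L¹` defect can then be computed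
exactly, and its total is twice the escaping mass.

Følner sets force spectral radius `1`. Bounded distortion bounds all powers of the operator by one
constant, and the correlation of the indicator of `X × A` with its `n`-th image bounds the norm of
the `n`-th power below by `1`.

The converse is the main point. Spectral radius `1` gives, for every `N`, a nonnegative `U` in
`ℓ²(V)` whose average over the inverse branches of order `N + 1` keeps a fixed proportion of its
`ℓ²` norm. Let `f` be the sum of the first `N` images of `U` under the transfer operator. The `L²`
norms of these images decrease, so for large `N` the function `U` is negligible compared with `f`.
Telescoping shows that `f` and `f ∘ T` are almost perfectly correlated, so `q = f²` is almost
invariant in `L¹` (`exists_almost_invariant_density`).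

It remains to pass from `X × V` to `V`. Distortion makes `q` almost constant on `[w] × {g}` for a
long word `w`. The iterate `Tⁿ` spreads this set over a whole fiber, and almost invariance carries
the small oscillation along (`fiberOscillation_wordPerm_le`). As `w` permutes the vertices, all
fibers are reached, so `q` is `L¹`-close to its fiber means `Q`. Hence `Q` is almost invariant under
the cocycle, and a layer cake argument finds a superlevel set of `Q` that is a Følner set
(`exists_escapeMass_le`). -/

lemma cylinder_zero (w : Fin 0 → ι) : cylinder θ α w = Set.univ :=
  Set.eq_univ_of_forall fun _ k => k.elim0

lemma cylinder_succ {n : ℕ} (w : Fin (n + 1) → ι) :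
    cylinder θ α w = α (w 0) ∩ θ ⁻¹' cylinder θ α (Fin.tail w) := by
  ext x
  simp only [cylinder, Set.mem_ofPred_eq, Set.mem_inter_iff, Set.mem_preimage, Fin.forall_fin_succ,
    Fin.tail, Fin.val_zero, Fin.val_succ, Function.iterate_zero, id_eq, Function.iterate_succ_apply]

lemma symbolicDist_le_one {r : ℝ} (h0 : 0 < r) (h1 : r < 1) (x y : X) :
    symbolicDist θ α r x y ≤ 1 := by
  unfold symbolicDist
  split_ifs
  · exact pow_le_one₀ h0.le h1.le
  · exact zero_le_one

lemma symbolicDist_le_of_mem_cylinder {r : ℝ} (h0 : 0 < r) (h1 : r < 1) {n : ℕ} {w : Fin n → ι}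
    {x y : X} (hx : x ∈ cylinder θ α w) (hy : y ∈ cylinder θ α w) :
    symbolicDist θ α r x y ≤ r ^ n := by
  unfold symbolicDist
  split_ifs with h
  · refine pow_le_pow_of_le_one h0.le h1.le (le_csInf h fun k hk => ?_)
    by_contra! hkn
    exact hk ⟨w ⟨k, hkn⟩, hx ⟨k, hkn⟩, hy ⟨k, hkn⟩⟩
  · positivity

/-- The permutation of the vertices induced by the first `n` steps of the orbit of `x`. -/
def iterPerm (θ : X → X) (κ : X → Equiv.Perm V) : ℕ → X → Equiv.Perm V
  | 0, _ => 1
  | n + 1, x => iterPerm θ κ n (θ x) * κ x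

lemma iterate_extensionMap (κ : X → Equiv.Perm V) (n : ℕ) (p : X × V) :
    (extensionMap θ κ)^[n] p = (θ^[n] p.1, iterPerm θ κ n p.1 p.2) := by
  induction n generalizing p with
  | zero => rfl
  | succ n ih =>
    rw [Function.iterate_succ_apply, ih]
    rfl

lemma IsNearestNeighbourCocycle.iterPerm_eq {G : Digraph V} {κ : X → Equiv.Perm V}
    (hκ : IsNearestNeighbourCocycle G α κ) {n : ℕ} {w : Fin n → ι} {x y : X}
    (hx : x ∈ cylinder θ α w) (hy : y ∈ cylinder θ α w) :
    iterPerm θ κ n x = iterPerm θ κ n y := by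
  induction n generalizing x y with
  | zero => rfl
  | succ n ih =>
    rw [cylinder_succ] at hx hy
    simp only [iterPerm]
    rw [ih hx.2 hy.2, hκ.const_on_atoms _ x hx.1 y hy.1]

open Classical in
/-- The permutation of the vertices induced by a word. -/
def wordPerm (θ : X → X) (α : ι → Set X) (κ : X → Equiv.Perm V) {n : ℕ} (w : Fin n → ι) :
    Equiv.Perm V :=
  if h : (cylinder θ α w).Nonempty then iterPerm θ κ n h.some else 1

lemma IsNearestNeighbourCocycle.iterPerm_eq_wordPerm {G : Digraph V} {κ : X → Equiv.Perm V}
    (hκ : IsNearestNeighbourCocycle G α κ) {n : ℕ} {w : Fin n → ι} {x : X}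
    (hx : x ∈ cylinder θ α w) : iterPerm θ κ n x = wordPerm θ α κ w := by
  have h : (cylinder θ α w).Nonempty := ⟨x, hx⟩
  rw [wordPerm, dif_pos h]
  exact hκ.iterPerm_eq hx h.some_mem

end Words

/-! ### Inverse branches and bounded distortion -/

section Branches

variable {X ι V : Type*} [MeasurableSpace X] {θ : X → X} {μ : Measure X} {α : ι → Set X}

lemma IsMarkovMap.pairwise_disjoint_cylinder (h : IsMarkovMap θ μ α) (n : ℕ) :
    Pairwise (Function.onFun Disjoint fun w : Fin n → ι => cylinder θ α w) := by
  intro w w' hw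
  obtain ⟨k, hk⟩ := Function.ne_iff.1 hw
  exact Set.disjoint_left.2 fun x hx hx' =>
    Set.disjoint_left.1 (h.pairwise_disjoint hk) (hx k) (hx' k)

lemma IsMarkovMap.exists_mem_atom (h : IsMarkovMap θ μ α) (x : X) : ∃ i, x ∈ α i := by
  exact Set.mem_iUnion.1 (h.iUnion_eq.symm ▸ Set.mem_univ x : x ∈ ⋃ i, α i)

lemma IsMarkovMap.iUnion_cylinder (h : IsMarkovMap θ μ α) (n : ℕ) :
    ⋃ w : Fin n → ι, cylinder θ α w = Set.univ := by
  refine Set.eq_univ_of_forall fun x => ?_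
  choose i hi using h.exists_mem_atom
  exact Set.mem_iUnion.2 ⟨fun k => i (θ^[k] x), fun k => hi _⟩

lemma IsMarkovMap.measurableSet_cylinder (h : IsMarkovMap θ μ α) (hθ : Measurable θ) {n : ℕ}
    (w : Fin n → ι) : MeasurableSet (cylinder θ α w) := by
  rw [show cylinder θ α w = ⋂ k : Fin n, θ^[k] ⁻¹' α (w k) by ext; simp [cylinder]]
  exact MeasurableSet.iInter fun k => hθ.iterate k (h.measurableSet_atom _)

/-- The measure `B ↦ μ([w] ∩ θ⁻ⁿ(B))`. -/
def branchMeasure (θ : X → X) (μ : Measure X) (α : ι → Set X) {n : ℕ} (w : Fin n → ι) :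
    Measure X :=
  (μ.restrict (cylinder θ α w)).map θ^[n]

lemma branchMeasure_le (hinv : MeasurePreserving θ μ μ) {n : ℕ} (w : Fin n → ι) :
    branchMeasure θ μ α w ≤ μ := by
  calc branchMeasure θ μ α w ≤ μ.map θ^[n] :=
        Measure.map_mono Measure.restrict_le_self (hinv.measurable.iterate n)
    _ = μ := (hinv.iterate n).map_eq

lemma branchMeasure_absolutelyContinuous (hinv : MeasurePreserving θ μ μ) {n : ℕ}
    (w : Fin n → ι) : branchMeasure θ μ α w ≪ μ :=
  Measure.absolutelyContinuous_of_le (branchMeasure_le hinv w)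

lemma branchMeasure_univ (hinv : MeasurePreserving θ μ μ) {n : ℕ} (w : Fin n → ι) :
    branchMeasure θ μ α w Set.univ = μ (cylinder θ α w) := by
  rw [branchMeasure, Measure.map_apply (hinv.measurable.iterate n) MeasurableSet.univ]
  simp

/-- Peel off the first letter: non-singularity of `θ` on that atom keeps null sets null, and full
branches make the part of `X` outside the image of the atom null. Consequently the branch densities
are positive a.e. -/
lemma IsFullGibbsMarkov.absolutelyContinuous_branchMeasure (h : IsFullGibbsMarkov θ μ α)
    (hinv : MeasurePreserving θ μ μ) {n : ℕ} (w : Fin n → ι) : μ ≪ branchMeasure θ μ α w := by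
  refine Measure.AbsolutelyContinuous.mk fun B hB h0 => ?_
  rw [branchMeasure, Measure.map_apply (hinv.measurable.iterate n) hB,
    Measure.restrict_apply (hinv.measurable.iterate n hB)] at h0
  induction n with
  | zero => simpa [cylinder_zero] using h0
  | succ n ih =>
    refine ih (Fin.tail w) ?_
    set D := θ^[n] ⁻¹' B ∩ cylinder θ α (Fin.tail w)
    have hD : MeasurableSet D := (hinv.measurable.iterate n hB).inter
      (h.toIsMarkovMap.measurableSet_cylinder hinv.measurable _)
    have h1 : μ (θ '' (α (w 0) ∩ θ ⁻¹' D)) = 0 := by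
      refine (h.nonsingular (w 0) _ Set.inter_subset_left
        ((h.measurableSet_atom _).inter (hinv.measurable hD))).2 ?_
      convert h0 using 2
      rw [cylinder_succ, Function.iterate_succ, Set.preimage_comp]
      ext x
      simp only [D, Set.mem_inter_iff, Set.mem_preimage]
      tauto
    refine measure_mono_null (t := θ '' (α (w 0) ∩ θ ⁻¹' D) ∪ (θ '' α (w 0))ᶜ) (fun x hx => ?_)
      (measure_union_null h1 (h.full_branches _))
    by_cases hx' : x ∈ θ '' α (w 0)
    · obtain ⟨y, hy, rfl⟩ := hx'
      exact Or.inl ⟨y, ⟨hy, hx⟩, rfl⟩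
    · exact Or.inr hx'

lemma IsMarkovMap.exists_inverse_branch (h : IsMarkovMap θ μ α) {n : ℕ} (w : Fin n → ι) :
    ∃ τ : X → X, Measurable τ ∧ ∀ x ∈ cylinder θ α w, τ (θ^[n] x) = x := by
  induction n with
  | zero => exact ⟨id, measurable_id, fun x _ => rfl⟩
  | succ n ih =>
    obtain ⟨τ', hτ', hτ'x⟩ := ih (Fin.tail w)
    obtain ⟨τ, hτ, hτx⟩ := (h.bimeasurable (w 0)).exists_measurable_extend
      (g := Subtype.val) measurable_subtype_coe fun x => ⟨x⟩
    refine ⟨τ ∘ τ', hτ.comp hτ', fun x hx => ?_⟩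
    rw [cylinder_succ] at hx
    rw [Function.iterate_succ_apply, Function.comp_apply, hτ'x _ hx.2]
    exact congrFun hτx ⟨x, hx.1⟩

lemma measurable_branchDensity {n : ℕ} (w : Fin n → ι) : Measurable (branchDensity θ μ α w) :=
  Measure.measurable_rnDeriv _ _

variable [IsProbabilityMeasure μ]

instance {n : ℕ} (w : Fin n → ι) : IsFiniteMeasure (branchMeasure θ μ α w) := by
  unfold branchMeasure; infer_instance

lemma lintegral_branchDensity_mul (hinv : MeasurePreserving θ μ μ) {n : ℕ} (w : Fin n → ι)
    {f : X → ℝ≥0∞} (hf : Measurable f) :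
    ∫⁻ x, branchDensity θ μ α w x * f x ∂μ = ∫⁻ x in cylinder θ α w, f (θ^[n] x) ∂μ := by
  have h := lintegral_rnDeriv_mul (branchMeasure_absolutelyContinuous (α := α) hinv w)
    hf.aemeasurable
  rw [branchMeasure, lintegral_map hf (hinv.measurable.iterate n)] at h
  exact h

lemma lintegral_branchDensity (hinv : MeasurePreserving θ μ μ) {n : ℕ} (w : Fin n → ι) :
    ∫⁻ x, branchDensity θ μ α w x ∂μ = μ (cylinder θ α w) := by
  simpa using lintegral_branchDensity_mul (α := α) hinv w (f := fun _ => 1) measurable_const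

/-- The branch densities are log-Hölder continuous with respect to the symbolic metric. -/
def HasDistortion (θ : X → X) (μ : Measure X) (α : ι → Set X) (C r : ℝ) : Prop :=
  ∀ᵐ x ∂μ, ∀ᵐ y ∂μ, ∀ (n : ℕ) (w : Fin n → ι),
    branchDensity θ μ α w x ≤
      ENNReal.ofReal (Real.exp (C * symbolicDist θ α r x y)) * branchDensity θ μ α w y ∧
    branchDensity θ μ α w y ≤
      ENNReal.ofReal (Real.exp (C * symbolicDist θ α r x y)) * branchDensity θ μ α w x

lemma ENNReal.le_ofReal_exp_mul {a b : ℝ≥0∞} {c : ℝ} (ha : a ≠ 0) (ha' : a ≠ ∞) (hb : b ≠ 0)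
    (hb' : b ≠ ∞) (h : Real.log a.toReal - Real.log b.toReal ≤ c) :
    a ≤ ENNReal.ofReal (Real.exp c) * b := by
  have ha0 := ENNReal.toReal_pos ha ha'
  have hb0 := ENNReal.toReal_pos hb hb'
  rw [← ENNReal.ofReal_toReal ha', ← ENNReal.ofReal_toReal hb',
    ← ENNReal.ofReal_mul (Real.exp_pos _).le]
  refine ENNReal.ofReal_le_ofReal ?_
  rw [← Real.log_le_log_iff ha0 (by positivity), Real.log_mul (Real.exp_pos _).ne' hb0.ne',
    Real.log_exp]
  linarith

/-- The Gibbs condition uses `Real.log` and `toReal`, which carry no information at `0` and `∞`.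
Once these values are excluded a.e., it becomes a multiplicative inequality. Countability of the set
of words allows one null set for all of them. -/
lemma IsFullGibbsMarkov.exists_hasDistortion [Countable ι] (h : IsFullGibbsMarkov θ μ α)
    (hinv : MeasurePreserving θ μ μ) :
    ∃ C r : ℝ, 0 < C ∧ 0 < r ∧ r < 1 ∧ HasDistortion θ μ α C r := by
  obtain ⟨C, hC, r, hr0, hr1, hg⟩ := h.gibbs
  refine ⟨C, r, hC, hr0, hr1, ?_⟩
  have hpos : ∀ᵐ x ∂μ, ∀ (n : ℕ) (w : Fin n → ι),
      branchDensity θ μ α w x ≠ 0 ∧ branchDensity θ μ α w x ≠ ∞ := by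
    rw [ae_all_iff]; intro n
    rw [ae_all_iff]; intro w
    filter_upwards [Measure.rnDeriv_pos' (h.absolutelyContinuous_branchMeasure hinv w),
      Measure.rnDeriv_lt_top (branchMeasure θ μ α w) μ] with x h1 h2
    exact ⟨h1.ne', h2.ne⟩
  have hg' : ∀ᵐ x ∂μ, ∀ᵐ y ∂μ, ∀ (n : ℕ) (w : Fin n → ι),
      |Real.log (branchDensity θ μ α w x).toReal - Real.log (branchDensity θ μ α w y).toReal|
        ≤ C * symbolicDist θ α r x y := by
    simpa only [ae_all_iff] using hg
  filter_upwards [hg', hpos] with x hx hx0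
  filter_upwards [hx, hpos] with y hy hy0
  intro n w
  have hxy := abs_le.1 (hy n w)
  refine ⟨ENNReal.le_ofReal_exp_mul (hx0 n w).1 (hx0 n w).2 (hy0 n w).1 (hy0 n w).2 hxy.2,
    ENNReal.le_ofReal_exp_mul (hy0 n w).1 (hy0 n w).2 (hx0 n w).1 (hx0 n w).2 ?_⟩
  linarith [hxy.1]

/-- Bounded distortion: the density of a branch is comparable to the measure of its cylinder. -/
def HasBoundedDensities (θ : X → X) (μ : Measure X) (α : ι → Set X) (K : ℝ≥0∞) : Prop :=
  ∀ᵐ x ∂μ, ∀ (n : ℕ) (w : Fin n → ι),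
    branchDensity θ μ α w x ≤ K * μ (cylinder θ α w) ∧
    μ (cylinder θ α w) ≤ K * branchDensity θ μ α w x

/-- The symbolic distance is at most `1`, so two values of a density differ by a factor of at most
`exp C`. Averaging over one of the two points replaces its value by the integral, which is the
measure of the cylinder. -/
lemma HasDistortion.hasBoundedDensities [Countable ι] {C r : ℝ} (h : HasDistortion θ μ α C r)
    (hC : 0 < C) (hr0 : 0 < r) (hr1 : r < 1) (hinv : MeasurePreserving θ μ μ) :
    HasBoundedDensities θ μ α (ENNReal.ofReal (Real.exp C)) := by
  unfold HasDistortion at h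
  filter_upwards [h] with x hx n w
  have hle : ∀ y, ENNReal.ofReal (Real.exp (C * symbolicDist θ α r x y)) ≤
      ENNReal.ofReal (Real.exp C) := fun y => by
    refine ENNReal.ofReal_le_ofReal (Real.exp_le_exp.2 ?_)
    nlinarith [symbolicDist_le_one (θ := θ) (α := α) hr0 hr1 x y]
  have hm := measurable_branchDensity (θ := θ) (μ := μ) (α := α) w
  constructor
  · calc branchDensity θ μ α w x = ∫⁻ _, branchDensity θ μ α w x ∂μ := by simp
      _ ≤ ∫⁻ y, ENNReal.ofReal (Real.exp C) * branchDensity θ μ α w y ∂μ := by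
        refine lintegral_mono_ae ?_
        filter_upwards [hx] with y hy
        exact (hy n w).1.trans (mul_le_mul_left (hle y) _)
      _ = _ := by rw [lintegral_const_mul _ hm, lintegral_branchDensity hinv]
  · calc μ (cylinder θ α w) = ∫⁻ y, branchDensity θ μ α w y ∂μ :=
          (lintegral_branchDensity hinv w).symm
      _ ≤ ∫⁻ _, ENNReal.ofReal (Real.exp C) * branchDensity θ μ α w x ∂μ := by
        refine lintegral_mono_ae ?_
        filter_upwards [hx] with y hy
        exact (hy n w).2.trans (mul_le_mul_left (hle y) _)
      _ = _ := by simp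

end Branches

/-! ### The product of `μ` with counting measure -/

section ProductWithCounting

variable {X V : Type*} [MeasurableSpace X] [MeasurableSpace V] [Countable V]
  [DiscreteMeasurableSpace V] {μ : Measure X}

lemma lintegral_prod_count [SFinite μ] {f : X × V → ℝ≥0∞} (hf : Measurable f) :
    ∫⁻ p, f p ∂(μ.prod Measure.count) = ∑' g, ∫⁻ x, f (x, g) ∂μ := by
  rw [lintegral_prod_symm _ hf.aemeasurable, lintegral_count]

lemma integral_prod_count [SFinite μ] {f : X × V → ℂ}
    (hf : Integrable f (μ.prod Measure.count)) :
    ∫ p, f p ∂(μ.prod Measure.count) = ∑' g, ∫ x, f (x, g) ∂μ := by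
  rw [integral_prod_symm _ hf, integral_countable hf.integral_prod_right]
  simp [Measure.real]

lemma ae_prod_count [SFinite μ] {P : X → V → Prop} (h : ∀ g, ∀ᵐ x ∂μ, P x g) :
    ∀ᵐ p ∂(μ.prod (Measure.count : Measure V)), P p.1 p.2 := by
  have h' : ∀ᵐ x ∂μ, ∀ g, P x g := ae_all_iff.2 h
  filter_upwards [Measure.quasiMeasurePreserving_fst.ae h'] with p hp using hp p.2

lemma map_perm_count (σ : Equiv.Perm V) :
    Measure.map σ (Measure.count : Measure V) = Measure.count := by
  ext s hs
  rw [Measure.map_apply (Measurable.of_discrete) hs, Measure.count_apply hs,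
    Measure.count_apply (Measurable.of_discrete (f := σ) hs)]
  congr 1
  exact Set.encard_preimage_of_bijective σ.bijective s

end ProductWithCounting

/-! ### The extension is measurable and measure preserving -/

section Extension

variable {X ι V : Type*} [MeasurableSpace X] [MeasurableSpace V] [Countable V]
  [DiscreteMeasurableSpace V] {θ : X → X} {μ : Measure X} {α : ι → Set X} {G : Digraph V}
  {κ : X → Equiv.Perm V}

/-- The cocycle is constant on atoms, so any set defined through it is a countable union of atoms.
-/
lemma IsNearestNeighbourCocycle.measurableSet_setOf [Countable ι]
    (hκ : IsNearestNeighbourCocycle G α κ) (h : IsMarkovMap θ μ α) (P : Equiv.Perm V → Prop) :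
    MeasurableSet {x | P (κ x)} := by
  have : {x | P (κ x)} = ⋃ i : {i // ∃ x ∈ α i, P (κ x)}, α i := by
    ext x
    simp only [Set.mem_ofPred_eq, Set.mem_iUnion, Subtype.exists, exists_prop]
    constructor
    · intro hx
      obtain ⟨i, hi⟩ := h.exists_mem_atom x
      exact ⟨i, ⟨x, hi, hx⟩, hi⟩
    · rintro ⟨i, ⟨y, hy, hyP⟩, hx⟩
      rwa [hκ.const_on_atoms i x hx y hy]
  rw [this]
  exact MeasurableSet.iUnion fun i => h.measurableSet_atom _

lemma IsNearestNeighbourCocycle.measurable_uncurry [Countable ι]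
    (hκ : IsNearestNeighbourCocycle G α κ) (h : IsMarkovMap θ μ α) :
    Measurable fun p : X × V => κ p.1 p.2 :=
  measurable_from_prod_countable_left fun g s _ =>
    hκ.measurableSet_setOf h fun σ => σ g ∈ s

lemma IsNearestNeighbourCocycle.measurable_extensionMap [Countable ι]
    (hκ : IsNearestNeighbourCocycle G α κ) (h : IsMarkovMap θ μ α) (hθ : Measurable θ) :
    Measurable (extensionMap θ κ) :=
  (hθ.comp measurable_fst).prodMk (hκ.measurable_uncurry h)

lemma IsNearestNeighbourCocycle.measurePreserving_extensionMap [Countable ι] [SFinite μ]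
    (hκ : IsNearestNeighbourCocycle G α κ) (h : IsMarkovMap θ μ α)
    (hinv : MeasurePreserving θ μ μ) :
    MeasurePreserving (extensionMap θ κ) (μ.prod Measure.count) (μ.prod Measure.count) :=
  hinv.skew_product (g := fun x => κ x) (hκ.measurable_uncurry h)
    (ae_of_all _ fun x => map_perm_count (κ x))

end Extension

/-! ### The space `ℋ_∞`, its pairing with `L¹`, and uniqueness of the transfer operator -/

section HInfty

variable {X V : Type*} [MeasurableSpace X] {μ : Measure X}

lemma Lp.ae_norm_le_norm_top (u : Lp ℂ ∞ μ) : ∀ᵐ x ∂μ, ‖u x‖ ≤ ‖u‖ := by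
  filter_upwards [ae_le_eLpNormEssSup (f := u) (μ := μ)] with x hx
  have h := Lp.memLp u
  rw [Lp.norm_def, eLpNorm_exponent_top]
  rw [← eLpNorm_exponent_top] at hx ⊢
  have := ENNReal.toReal_mono h.eLpNorm_ne_top hx
  rwa [toReal_enorm] at this

lemma Lp.norm_le_of_ae_bound_top [IsFiniteMeasure μ] {u : Lp ℂ ∞ μ} {c : ℝ} (hc : 0 ≤ c)
    (h : ∀ᵐ x ∂μ, ‖u x‖ ≤ c) : ‖u‖ ≤ c := by
  simpa using Lp.norm_le_of_ae_bound hc h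

lemma Lp.integrable_top [IsFiniteMeasure μ] (u : Lp ℂ ∞ μ) : Integrable u μ :=
  (Lp.memLp u).integrable le_top

lemma norm_sq_eq_tsum (f : HInfty μ V) : ‖f‖ ^ 2 = ∑' g, ‖f g‖ ^ 2 := by
  simpa using lp.norm_rpow_eq_tsum (p := 2) (by norm_num) f

lemma summable_norm_sq (f : HInfty μ V) : Summable fun g => ‖f g‖ ^ 2 := by
  simpa using (lp.memℓp f).summable (by norm_num)

variable [MeasurableSpace V] [Countable V] [DiscreteMeasurableSpace V]

lemma measurable_toFun (f : HInfty μ V) : Measurable (toFun f) :=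
  measurable_from_prod_countable_left fun g => (Lp.stronglyMeasurable (f g)).measurable

variable [SFinite μ]

lemma ae_norm_toFun_le (f : HInfty μ V) :
    ∀ᵐ p ∂(μ.prod Measure.count), ‖toFun f p‖ ≤ ‖f‖ := by
  refine ae_prod_count (P := fun x g => ‖f g x‖ ≤ ‖f‖) fun g => ?_
  filter_upwards [Lp.ae_norm_le_norm_top (f g)] with x hx
  exact hx.trans (lp.norm_apply_le_norm (by norm_num) f g)

lemma integrable_toFun_mul (f : HInfty μ V) {h : X × V → ℂ}
    (hh : Integrable h (μ.prod Measure.count)) :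
    Integrable (fun p => toFun f p * h p) (μ.prod Measure.count) :=
  hh.bdd_mul (measurable_toFun f).aestronglyMeasurable (ae_norm_toFun_le f)

lemma norm_integral_toFun_mul_le (f : HInfty μ V) {h : X × V → ℂ}
    (hh : Integrable h (μ.prod Measure.count)) :
    ‖∫ p, toFun f p * h p ∂(μ.prod Measure.count)‖ ≤
      (∫ p, ‖h p‖ ∂(μ.prod Measure.count)) * ‖f‖ := by
  rw [mul_comm, ← integral_const_mul]
  refine norm_integral_le_of_norm_le (hh.norm.const_mul _) ?_
  filter_upwards [ae_norm_toFun_le f] with p hp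
  rw [norm_mul]
  gcongr

lemma ae_toFun_add (f f' : HInfty μ V) :
    ∀ᵐ p ∂(μ.prod Measure.count), toFun (f + f') p = toFun f p + toFun f' p :=
  ae_prod_count (P := fun x g => (f + f') g x = f g x + f' g x) fun _ => Lp.coeFn_add _ _

lemma ae_toFun_smul (c : ℂ) (f : HInfty μ V) :
    ∀ᵐ p ∂(μ.prod Measure.count), toFun (c • f) p = c * toFun f p :=
  ae_prod_count (P := fun x g => (c • f) g x = c * f g x) fun _ => Lp.coeFn_smul _ _

/-- Integration against an integrable function as a functional on `ℋ_∞`. -/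
def integralCLM {h : X × V → ℂ} (hh : Integrable h (μ.prod Measure.count)) :
    HInfty μ V →L[ℂ] ℂ :=
  LinearMap.mkContinuous
    { toFun := fun f => ∫ p, toFun f p * h p ∂(μ.prod Measure.count)
      map_add' := fun f f' => by
        rw [← integral_add (integrable_toFun_mul f hh) (integrable_toFun_mul f' hh)]
        refine integral_congr_ae ?_
        filter_upwards [ae_toFun_add f f'] with p hp
        rw [hp, add_mul]
      map_smul' := fun c f => by
        rw [RingHom.id_apply, smul_eq_mul, ← integral_const_mul]
        refine integral_congr_ae ?_
        filter_upwards [ae_toFun_smul c f] with p hp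
        rw [hp, mul_assoc] }
    _ fun f => norm_integral_toFun_mul_le f hh

lemma integrable_indicator_one {s : Set (X × V)} (hs : MeasurableSet s)
    (h : μ.prod Measure.count s ≠ ∞) :
    Integrable (s.indicator fun _ => (1 : ℂ)) (μ.prod Measure.count) :=
  (integrable_indicator_iff hs).2 (integrableOn_const h)

lemma prod_count_singleton (B : Set X) (g : V) :
    μ.prod (Measure.count : Measure V) (B ×ˢ {g}) = μ B := by
  rw [Measure.prod_prod, Measure.count_singleton, mul_one]

lemma integral_toFun_mul_indicator [IsFiniteMeasure μ] (f : HInfty μ V) {B : Set X}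
    (hB : MeasurableSet B) (g : V) :
    ∫ p, toFun f p * (B ×ˢ {g}).indicator (fun _ => (1 : ℂ)) p ∂(μ.prod Measure.count) =
      ∫ x in B, f g x ∂μ := by
  have hi := integrable_indicator_one (μ := μ) (hB.prod (measurableSet_singleton g))
    (by rw [prod_count_singleton]; exact measure_ne_top μ B)
  rw [integral_prod_count (integrable_toFun_mul f hi), tsum_eq_single g, ← integral_indicator hB]
  · refine integral_congr_ae (ae_of_all _ fun x => ?_)
    by_cases hx : x ∈ B <;> simp [toFun, hx]
  · intro g' hg'
    simp [hg']

/-- The indicators of `B × {g}` are integrable and already separate points. -/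
lemma HInfty.ext_of_forall_integral [IsFiniteMeasure μ] {f f' : HInfty μ V}
    (H : ∀ h : X × V → ℂ, Integrable h (μ.prod Measure.count) →
      ∫ p, toFun f p * h p ∂(μ.prod Measure.count) =
        ∫ p, toFun f' p * h p ∂(μ.prod Measure.count)) : f = f' := by
  refine lp.ext (funext fun g => Lp.ext ?_)
  refine (Lp.integrable_top _).ae_eq_of_forall_setIntegral_eq _ _ (Lp.integrable_top _)
    fun B hB _ => ?_
  rw [← integral_toFun_mul_indicator f hB, ← integral_toFun_mul_indicator f' hB]
  refine H _ (integrable_indicator_one (hB.prod (measurableSet_singleton g)) ?_)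
  rw [prod_count_singleton]
  exact measure_ne_top μ B

lemma IsTransferOperator.unique [IsFiniteMeasure μ] {S : X × V → X × V}
    {L L' : HInfty μ V →L[ℂ] HInfty μ V} (hL : IsTransferOperator S L)
    (hL' : IsTransferOperator S L') : L = L' :=
  ContinuousLinearMap.ext fun f => HInfty.ext_of_forall_integral fun h hh =>
    (hL f h hh).trans (hL' f h hh).symm

lemma IsTransferOperator.pow {S : X × V → X × V}
    (hS : MeasurePreserving S (μ.prod Measure.count) (μ.prod Measure.count))
    {L : HInfty μ V →L[ℂ] HInfty μ V} (hL : IsTransferOperator S L) (n : ℕ) :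
    IsTransferOperator S^[n] (L ^ n) := by
  induction n with
  | zero => intro f h _; simp
  | succ n ih =>
    intro f h hh
    rw [pow_succ', mul_apply_eq_comp, hL _ _ hh,
      ih f (fun p => h (S p)) (hS.integrable_comp_of_integrable hh)]
    simp only [Function.iterate_succ_apply']

end HInfty

/-! ### Operators that permute the fibers and act on each of them -/

section FiberOperators

variable {X V : Type*} [MeasurableSpace X] {μ : Measure X}

lemma summable_norm_sq_perm (f : HInfty μ V) (σ : Equiv.Perm V) :
    Summable fun g => ‖f (σ g)‖ ^ 2 :=
  σ.summable_iff.2 (summable_norm_sq f)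

lemma norm_sq_apply_le (A : Lp ℂ ∞ μ →L[ℂ] Lp ℂ ∞ μ) (u : Lp ℂ ∞ μ) :
    ‖A u‖ ^ 2 ≤ ‖A‖ ^ 2 * ‖u‖ ^ 2 := by
  rw [← mul_pow]
  exact pow_le_pow_left₀ (norm_nonneg _) (A.le_opNorm _) 2

lemma summable_norm_sq_fiberwise (A : Lp ℂ ∞ μ →L[ℂ] Lp ℂ ∞ μ) (σ : Equiv.Perm V)
    (f : HInfty μ V) : Summable fun g => ‖A (f (σ g))‖ ^ 2 :=
  Summable.of_nonneg_of_le (fun _ => by positivity) (fun _ => norm_sq_apply_le A _)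
    ((summable_norm_sq_perm f σ).mul_left _)

/-- The function `g ↦ A (f (σ g))` as an element of `ℋ_∞`. -/
def fiberwise (A : Lp ℂ ∞ μ →L[ℂ] Lp ℂ ∞ μ) (σ : Equiv.Perm V) (f : HInfty μ V) : HInfty μ V :=
  ⟨fun g => A (f (σ g)), memℓp_gen (by simpa using summable_norm_sq_fiberwise A σ f)⟩

lemma fiberwise_apply (A : Lp ℂ ∞ μ →L[ℂ] Lp ℂ ∞ μ) (σ : Equiv.Perm V) (f : HInfty μ V)
    (g : V) : fiberwise A σ f g = A (f (σ g)) := rfl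

lemma norm_fiberwise_le (A : Lp ℂ ∞ μ →L[ℂ] Lp ℂ ∞ μ) (σ : Equiv.Perm V) (f : HInfty μ V) :
    ‖fiberwise A σ f‖ ≤ ‖A‖ * ‖f‖ := by
  refine (sq_le_sq₀ (norm_nonneg _) (by positivity)).1 ?_
  rw [mul_pow, norm_sq_eq_tsum, norm_sq_eq_tsum, ← tsum_mul_left,
    ← σ.tsum_eq fun g => ‖A‖ ^ 2 * ‖f g‖ ^ 2]
  exact Summable.tsum_le_tsum (fun _ => norm_sq_apply_le A _) (summable_norm_sq_fiberwise A σ f)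
    ((summable_norm_sq_perm f σ).mul_left _)

/-- The operator on `ℋ_∞` that permutes the fibers by `σ` and applies `A` to each of them. -/
def fiberwiseCLM (A : Lp ℂ ∞ μ →L[ℂ] Lp ℂ ∞ μ) (σ : Equiv.Perm V) :
    HInfty μ V →L[ℂ] HInfty μ V :=
  LinearMap.mkContinuous
    { toFun := fiberwise A σ
      map_add' := fun f f' => lp.ext (funext fun g => by
        rw [lp.coeFn_add, Pi.add_apply]
        simp only [fiberwise_apply]
        rw [lp.coeFn_add, Pi.add_apply, map_add])
      map_smul' := fun c f => lp.ext (funext fun g => by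
        rw [lp.coeFn_smul, Pi.smul_apply]
        simp only [fiberwise_apply]
        rw [lp.coeFn_smul, Pi.smul_apply, map_smul, RingHom.id_apply]) }
    ‖A‖ (norm_fiberwise_le A σ)

lemma fiberwiseCLM_apply (A : Lp ℂ ∞ μ →L[ℂ] Lp ℂ ∞ μ) (σ : Equiv.Perm V) (f : HInfty μ V)
    (g : V) : fiberwiseCLM A σ f g = A (f (σ g)) := rfl

lemma norm_fiberwiseCLM_le (A : Lp ℂ ∞ μ →L[ℂ] Lp ℂ ∞ μ) (σ : Equiv.Perm V) :
    ‖fiberwiseCLM A σ‖ ≤ ‖A‖ :=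
  LinearMap.mkContinuous_norm_le _ (norm_nonneg _) _

end FiberOperators

/-! ### Existence of the transfer operators, with a norm bound uniform in the iterate -/

section BranchOperators

variable {X ι V : Type*} [MeasurableSpace X] {θ : X → X} {μ : Measure X} {α : ι → Set X}
  [IsProbabilityMeasure μ]

/-- The operator is `u ↦ φ_w · (u ∘ τ_w)`. Its norm is controlled by the essential supremum of
`φ_w`, which bounded distortion compares with the measure of the cylinder. -/
lemma IsFullGibbsMarkov.exists_branchOperator (h : IsFullGibbsMarkov θ μ α)
    (hinv : MeasurePreserving θ μ μ) {K : ℝ≥0∞} (hK : K ≠ ∞)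
    (hb : HasBoundedDensities θ μ α K) {n : ℕ} (w : Fin n → ι) :
    ∃ A : Lp ℂ ∞ μ →L[ℂ] Lp ℂ ∞ μ, ‖A‖ ≤ (K * μ (cylinder θ α w)).toReal ∧
      ∀ (u : Lp ℂ ∞ μ) (k : X → ℂ), Integrable k μ →
        ∫ x, A u x * k x ∂μ = ∫ x in cylinder θ α w, u x * k (θ^[n] x) ∂μ := by
  obtain ⟨τ, hτ, hτx⟩ := h.toIsMarkovMap.exists_inverse_branch w
  have hθn := hinv.measurable.iterate n
  have hcyl := h.toIsMarkovMap.measurableSet_cylinder hinv.measurable w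
  -- Composition with `τ` must respect a.e. equality. The part of `θⁿ`-preimage of `τ⁻¹ B` inside
  -- the cylinder lies in `B`, so the positivity of the branch density transfers nullity.
  have hq : Measure.QuasiMeasurePreserving τ μ μ := by
    refine ⟨hτ, Measure.AbsolutelyContinuous.mk fun B hB h0 => ?_⟩
    rw [Measure.map_apply hτ hB]
    refine h.absolutelyContinuous_branchMeasure hinv w ?_
    rw [branchMeasure, Measure.map_apply hθn (hτ hB), Measure.restrict_apply (hθn (hτ hB))]
    refine measure_mono_null (fun x hx => ?_) h0
    simpa [hτx x hx.2] using hx.1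
  set φ := branchDensity θ μ α w
  set c := (K * μ (cylinder θ α w)).toReal
  have hφ : ∀ᵐ x ∂μ, (φ x).toReal ≤ c := by
    filter_upwards [hb] with x hx
    exact ENNReal.toReal_mono (ENNReal.mul_ne_top hK (measure_ne_top _ _)) (hx n w).1
  have hφm : Measurable fun x => ((φ x).toReal : ℂ) :=
    Complex.measurable_ofReal.comp (measurable_branchDensity w).ennreal_toReal
  have hmeas : ∀ u : Lp ℂ ∞ μ, AEStronglyMeasurable (fun x => ((φ x).toReal : ℂ) * u (τ x)) μ :=
    fun u => hφm.aestronglyMeasurable.mul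
      ((Lp.stronglyMeasurable u).comp_measurable hτ).aestronglyMeasurable
  have hbound : ∀ u : Lp ℂ ∞ μ, ∀ᵐ x ∂μ, ‖((φ x).toReal : ℂ) * u (τ x)‖ ≤ c * ‖u‖ := by
    intro u
    filter_upwards [hφ, hq.ae (Lp.ae_norm_le_norm_top u)] with x h1 h2
    rw [norm_mul, Complex.norm_real, Real.norm_of_nonneg ENNReal.toReal_nonneg]
    gcongr
  have hmem := fun u : Lp ℂ ∞ μ => memLp_top_of_bound (hmeas u) _ (hbound u)
  refine ⟨LinearMap.mkContinuous
    { toFun := fun u => (hmem u).toLp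
      map_add' := fun u u' => by
        refine Lp.ext ?_
        filter_upwards [(hmem (u + u')).coeFn_toLp, (hmem u).coeFn_toLp, (hmem u').coeFn_toLp,
          Lp.coeFn_add (hmem u).toLp (hmem u').toLp, hq.ae (Lp.coeFn_add u u')]
          with x h1 h2 h3 h4 h5
        rw [h1, h4, Pi.add_apply, h2, h3, h5, Pi.add_apply, mul_add]
      map_smul' := fun a u => by
        refine Lp.ext ?_
        filter_upwards [(hmem (a • u)).coeFn_toLp, (hmem u).coeFn_toLp,
          Lp.coeFn_smul a (hmem u).toLp, hq.ae (Lp.coeFn_smul a u)] with x h1 h2 h3 h4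
        rw [h1, RingHom.id_apply, h3, Pi.smul_apply, h2, h4, Pi.smul_apply, smul_eq_mul,
          smul_eq_mul, mul_left_comm] } c fun u => ?_,
    LinearMap.mkContinuous_norm_le _ ENNReal.toReal_nonneg _, fun u k hk => ?_⟩
  · refine Lp.norm_le_of_ae_bound_top (mul_nonneg ENNReal.toReal_nonneg (norm_nonneg _)) ?_
    filter_upwards [(hmem u).coeFn_toLp, hbound u] with x h1 h2
    exact (congrArg norm h1).trans_le h2
  · have hac := branchMeasure_absolutelyContinuous (α := α) hinv w
    have hmk : AEStronglyMeasurable (fun x => u (τ x) * k x) μ :=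
      ((Lp.stronglyMeasurable u).comp_measurable hτ).aestronglyMeasurable.mul
        hk.aestronglyMeasurable
    calc ∫ x, (hmem u).toLp _ x * k x ∂μ
        = ∫ x, (φ x).toReal • (u (τ x) * k x) ∂μ := by
          refine integral_congr_ae ?_
          filter_upwards [(hmem u).coeFn_toLp] with x hx
          rw [hx, Complex.real_smul, mul_assoc]
      _ = ∫ x, u (τ x) * k x ∂(branchMeasure θ μ α w) := integral_rnDeriv_smul hac
      _ = ∫ x in cylinder θ α w, u (τ (θ^[n] x)) * k (θ^[n] x) ∂μ :=
          integral_map hθn.aemeasurable (hmk.mono_ac hac)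
      _ = _ := setIntegral_congr_fun hcyl fun x hx => by simp only [hτx x hx]

variable [MeasurableSpace V] [Countable V] [DiscreteMeasurableSpace V] [Countable ι]
  {G : Digraph V} {κ : X → Equiv.Perm V}

/-- Over one cylinder, `Tⁿ` acts on the vertices by one fixed permutation. Reindexing the sum over
the fibers by it reduces the claim to the duality on a single fiber. -/
lemma IsFullGibbsMarkov.integral_fiberwiseCLM (h : IsFullGibbsMarkov θ μ α)
    (hinv : MeasurePreserving θ μ μ) (hκ : IsNearestNeighbourCocycle G α κ) {n : ℕ}
    (w : Fin n → ι) {A : Lp ℂ ∞ μ →L[ℂ] Lp ℂ ∞ μ}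
    (hA : ∀ (u : Lp ℂ ∞ μ) (k : X → ℂ), Integrable k μ →
        ∫ x, A u x * k x ∂μ = ∫ x in cylinder θ α w, u x * k (θ^[n] x) ∂μ)
    (f : HInfty μ V) {k : X × V → ℂ} (hk : Integrable k (μ.prod Measure.count)) :
    ∫ p, toFun (fiberwiseCLM A (wordPerm θ α κ w)⁻¹ f) p * k p ∂(μ.prod Measure.count) =
      ∫ p in cylinder θ α w ×ˢ Set.univ, toFun f p * k ((extensionMap θ κ)^[n] p)
        ∂(μ.prod Measure.count) := by
  have hcyl := h.toIsMarkovMap.measurableSet_cylinder hinv.measurable w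
  have hT := (hκ.measurePreserving_extensionMap h.toIsMarkovMap hinv).iterate n
  have hi : Integrable (fun p => toFun f p * k ((extensionMap θ κ)^[n] p)) (μ.prod Measure.count) :=
    integrable_toFun_mul f (hT.integrable_comp_of_integrable hk)
  have hk' : ∀ g, Integrable (fun x => k (x, g)) μ :=
    Measure.ae_count_iff.1 hk.prod_left_ae
  rw [← integral_indicator (hcyl.prod MeasurableSet.univ),
    integral_prod_count (hi.indicator (hcyl.prod MeasurableSet.univ)),
    integral_prod_count (integrable_toFun_mul _ hk), ← (wordPerm θ α κ w).tsum_eq]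
  refine tsum_congr fun g => ?_
  simp only [toFun, fiberwiseCLM_apply, Equiv.Perm.inv_def, Equiv.symm_apply_apply]
  rw [hA _ _ (hk' _), ← integral_indicator hcyl]
  refine integral_congr_ae (ae_of_all _ fun x => ?_)
  by_cases hx : x ∈ cylinder θ α w
  · simp [hx, iterate_extensionMap, hκ.iterPerm_eq_wordPerm hx]
  · simp [hx]

lemma IsMarkovMap.tsum_measure_cylinder (h : IsMarkovMap θ μ α) (hθ : Measurable θ) (n : ℕ) :
    ∑' w : Fin n → ι, μ (cylinder θ α w) = 1 := by
  rw [← measure_iUnion (h.pairwise_disjoint_cylinder n) fun w => h.measurableSet_cylinder hθ w,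
    h.iUnion_cylinder, measure_univ]

lemma IsMarkovMap.hasSum_mul_measure_cylinder (h : IsMarkovMap θ μ α) (hθ : Measurable θ)
    {K : ℝ≥0∞} (hK : K ≠ ∞) (n : ℕ) :
    HasSum (fun w : Fin n → ι => (K * μ (cylinder θ α w)).toReal) K.toReal := by
  have h1 : ∑' w : Fin n → ι, K * μ (cylinder θ α w) = K := by
    rw [ENNReal.tsum_mul_left, h.tsum_measure_cylinder hθ, mul_one]
  have h2 := ENNReal.hasSum_toReal (f := fun w : Fin n → ι => K * μ (cylinder θ α w))
    (by rw [h1]; exact hK)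
  rwa [← ENNReal.tsum_toReal_eq fun w => ENNReal.mul_ne_top hK (measure_ne_top _ _), h1] at h2

lemma lp_hasSum_apply {J : Type*} {F : J → HInfty μ V} {f : HInfty μ V} (h : HasSum F f) (g : V) :
    HasSum (fun j => F j g) (f g) :=
  (lp.evalCLM ℂ (fun _ : V => Lp ℂ ∞ μ) 2 g).hasSum h

/-- The iterates of the graph extension have transfer operators, with explicit norm bounds. -/
lemma IsFullGibbsMarkov.exists_isTransferOperator_iterate (h : IsFullGibbsMarkov θ μ α)
    (hinv : MeasurePreserving θ μ μ) (hκ : IsNearestNeighbourCocycle G α κ) {K : ℝ≥0∞}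
    (hK : K ≠ ∞) (hb : HasBoundedDensities θ μ α K) (n : ℕ) :
    ∃ L : HInfty μ V →L[ℂ] HInfty μ V, IsTransferOperator (extensionMap θ κ)^[n] L ∧
      ‖L‖ ≤ K.toReal ∧
      ∀ (f : HInfty μ V) (g : V), ‖L f g‖ₑ ≤
        K * ∑' w : Fin n → ι, μ (cylinder θ α w) * ‖f ((wordPerm θ α κ w)⁻¹ g)‖ₑ := by
  choose A hAn hA using fun w : Fin n → ι => h.exists_branchOperator hinv hK hb w
  have hT := (hκ.measurePreserving_extensionMap h.toIsMarkovMap hinv).iterate n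
  have hcyl := fun w : Fin n → ι => h.toIsMarkovMap.measurableSet_cylinder hinv.measurable w
  have hdisj := h.toIsMarkovMap.pairwise_disjoint_cylinder n
  have hsumK := h.toIsMarkovMap.hasSum_mul_measure_cylinder hinv.measurable hK n
  obtain ⟨M, hMdef⟩ : ∃ M : (Fin n → ι) → (HInfty μ V →L[ℂ] HInfty μ V),
      ∀ w, M w = fiberwiseCLM (V := V) (A w) (wordPerm θ α κ w)⁻¹ := ⟨_, fun _ => rfl⟩
  have hM : ∀ w, ‖M w‖ ≤ (K * μ (cylinder θ α w)).toReal := fun w => by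
    rw [hMdef]
    exact (norm_fiberwiseCLM_le _ _).trans (hAn w)
  -- The cylinders of order `n` partition `X`, so the norm bounds of the branches add up to `K`,
  -- whatever `n` is.
  obtain ⟨L, hMs⟩ := Summable.of_norm_bounded hsumK.summable hM
  have hMf : ∀ f, HasSum (fun w => M w f) (L f) := fun f =>
    (ContinuousLinearMap.apply ℂ (HInfty μ V) f).hasSum hMs
  refine ⟨L, fun f k hk => ?_, hMs.norm_le_of_bounded hsumK hM, fun f g => ?_⟩
  · have hkT := hT.integrable_comp_of_integrable hk
    have h1 : HasSum (fun w => ∫ p, toFun (M w f) p * k p ∂(μ.prod Measure.count))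
      (∫ p, toFun (L f) p * k p ∂(μ.prod Measure.count)) := (integralCLM hk).hasSum (hMf f)
    have hdisj' : Pairwise (Function.onFun Disjoint
        fun w : Fin n → ι => cylinder θ α w ×ˢ (Set.univ : Set V)) := fun w w' hw =>
      Set.disjoint_left.2 fun p hp hp' => Set.disjoint_left.1 (hdisj hw) hp.1 hp'.1
    have h2 := hasSum_integral_iUnion (fun w => (hcyl w).prod MeasurableSet.univ) hdisj'
      (integrable_toFun_mul f hkT).integrableOn
    rw [← Set.iUnion_prod_const, h.toIsMarkovMap.iUnion_cylinder, Set.univ_prod_univ,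
      setIntegral_univ] at h2
    simp only [hMdef, h.integral_fiberwiseCLM hinv hκ _ (hA _) f hk] at h1
    exact h1.unique h2
  · rw [← (lp_hasSum_apply (hMf f) g).tsum_eq, ← ENNReal.tsum_mul_left]
    refine enorm_tsum_le_tsum_enorm.trans (ENNReal.tsum_le_tsum fun w => ?_)
    rw [hMdef, fiberwiseCLM_apply, ← mul_assoc]
    have h1 : ‖A w‖ₑ ≤ K * μ (cylinder θ α w) := by
      rw [← ofReal_norm, ← ENNReal.ofReal_toReal (ENNReal.mul_ne_top hK (measure_ne_top _ _))]
      exact ENNReal.ofReal_le_ofReal (hAn w)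
    calc ‖A w (f ((wordPerm θ α κ w)⁻¹ g))‖ₑ ≤ ‖A w‖ₑ * ‖f ((wordPerm θ α κ w)⁻¹ g)‖ₑ :=
          (A w).le_opENorm _
      _ ≤ _ := by gcongr

end BranchOperators

/-! ### Almost invariant finite sets and amenability -/

section Folner

variable {X ι V : Type*} [MeasurableSpace X] [MeasurableSpace V] [Countable V]
  [DiscreteMeasurableSpace V] {θ : X → X} {μ : Measure X} {α : ι → Set X} {G : Digraph V}
  {κ : X → Equiv.Perm V}

/-- The set `X × A`. -/
def fiberSet (X : Type*) {V : Type*} (A : Finset V) : Set (X × V) := {p | p.2 ∈ A}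

lemma measurableSet_fiberSet (A : Finset V) : MeasurableSet (fiberSet X A) :=
  measurable_snd (MeasurableSet.of_discrete (s := (A : Set V)))

/-- The mass of the points of `X × A` that leave `X × A` in one step. -/
def escapeMass (μ : Measure X) (S : X × V → X × V) (A : Finset V) : ℝ≥0∞ :=
  μ.prod Measure.count (fiberSet X A \ S ⁻¹' fiberSet X A)

/-- There are finite sets `A` such that `X × A` is almost invariant. -/
def HasFolnerSets (μ : Measure X) (S : X × V → X × V) : Prop :=
  ∀ ε : ℝ, 0 < ε → ∃ A : Finset V, A.Nonempty ∧
    escapeMass μ S A ≤ ENNReal.ofReal ε * (A.card : ℝ≥0∞)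

lemma measure_prod_count [SFinite μ] {s : Set (X × V)} (hs : MeasurableSet s) :
    μ.prod Measure.count s = ∑' g, μ {x | (x, g) ∈ s} := by
  rw [Measure.prod_apply_symm hs, lintegral_count]
  rfl

lemma measure_fiberSet [IsProbabilityMeasure μ] (A : Finset V) :
    μ.prod Measure.count (fiberSet X A) = A.card := by
  rw [measure_prod_count (measurableSet_fiberSet A), tsum_eq_sum (s := A)]
  · rw [Finset.sum_congr rfl (g := fun _ => 1)]
    · simp
    · intro g hg
      simp [fiberSet, hg]
  · intro g hg
    simp [fiberSet, hg]

/-- A point of `X × A` that is outside at time `n + 1` either leaves at the first step, or its image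
is in `X × A` and is outside `n` steps later. By invariance each step costs one escape mass. -/
lemma measure_fiberSet_diff_iterate_le {S : X × V → X × V} [SFinite μ]
    (hS : MeasurePreserving S (μ.prod Measure.count) (μ.prod Measure.count)) (A : Finset V)
    (n : ℕ) : μ.prod Measure.count (fiberSet X A \ S^[n] ⁻¹' fiberSet X A) ≤
      n * escapeMass μ S A := by
  induction n with
  | zero => simp
  | succ n ih =>
    have hB := measurableSet_fiberSet (X := X) A
    calc μ.prod Measure.count (fiberSet X A \ S^[n + 1] ⁻¹' fiberSet X A)
        ≤ μ.prod Measure.count ((fiberSet X A \ S ⁻¹' fiberSet X A) ∪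
            S ⁻¹' (fiberSet X A \ S^[n] ⁻¹' fiberSet X A)) := by
          refine measure_mono fun p hp => ?_
          by_cases h : S p ∈ fiberSet X A
          · exact Or.inr ⟨h, hp.2⟩
          · exact Or.inl ⟨hp.1, h⟩
      _ ≤ escapeMass μ S A + n * escapeMass μ S A := by
          refine (measure_union_le _ _).trans (add_le_add le_rfl ?_)
          rwa [hS.measure_preimage
            (hB.diff ((hS.measurable.iterate n) hB)).nullMeasurableSet]
      _ = _ := by push_cast; ring

variable [Countable ι]

lemma IsNearestNeighbourCocycle.escapeMass_eq [SFinite μ]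
    (hκ : IsNearestNeighbourCocycle G α κ) (h : IsMarkovMap θ μ α) (hθ : Measurable θ)
    (A : Finset V) :
    escapeMass μ (extensionMap θ κ) A = ∑ v ∈ A, μ {x | κ x v ∉ A} := by
  have hB := measurableSet_fiberSet (X := X) A
  rw [escapeMass, measure_prod_count (hB.diff (hκ.measurable_extensionMap h hθ hB)),
    tsum_eq_sum (s := A)]
  · refine Finset.sum_congr rfl fun v hv => ?_
    congr 1
    ext x
    simp [fiberSet, hv, extensionMap]
  · intro v hv
    simp [fiberSet, hv]

/-- Take a finite set `F` of atoms missing mass less than `ε / 2`, and `δ` below the mass of every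
atom in `F`. An atom of `F` that moves `v` out of `K` gives an edge of weight above `δ`. So off the
`δ`-boundary only the atoms outside `F` let mass escape, and boundary vertices lose at most mass `1`
each. -/
lemma IsMuAmenable.hasFolnerSets [Nonempty V] [IsProbabilityMeasure μ]
    (hκ : IsNearestNeighbourCocycle G α κ) (h : IsMarkovMap θ μ α) (hθ : Measurable θ)
    (ha : IsMuAmenable G μ κ) : HasFolnerSets μ (extensionMap θ κ) := by
  intro ε hε
  have hsum : ∑' i, μ (α i) ≠ ∞ := by
    rw [← measure_iUnion h.pairwise_disjoint h.measurableSet_atom]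
    exact measure_ne_top _ _
  obtain ⟨F, hF⟩ := ((tendsto_order.1 (ENNReal.tendsto_tsum_compl_atTop_zero hsum)).2
    (ENNReal.ofReal (ε / 2)) (by positivity)).exists
  have h1 := (tendsto_order.1 ha).2 (ε / 2) (by positivity)
  have h2 : ∀ᶠ δ in 𝓝[>] (0 : ℝ), ∀ i ∈ F, δ < μ.real (α i) := by
    refine (Finset.eventually_all F).2 fun i _ => ?_
    exact eventually_nhdsWithin_of_eventually_nhds (eventually_lt_nhds
      (ENNReal.toReal_pos (h.measure_atom_pos i).ne' (measure_ne_top _ _)))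
  obtain ⟨δ, hδ1, hδ2⟩ := (h1.and h2).exists
  -- A real infimum over an empty family would be `0` by convention, with no set attaining a small
  -- ratio.
  have : Nonempty {K : Finset V // K.Nonempty} :=
    ⟨⟨{Classical.arbitrary V}, Finset.singleton_nonempty _⟩⟩
  obtain ⟨⟨K, hK⟩, hKb⟩ := exists_lt_of_ciInf_lt hδ1
  refine ⟨K, hK, ?_⟩
  classical
  have hfin : (epsBoundary G (canonicalWeight μ κ) δ K).Finite :=
    K.finite_toSet.subset fun v hv => hv.1
  set D := hfin.toFinset with hD
  have hDK : D ⊆ K := fun v hv => (hfin.mem_toFinset.1 hv).1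
  rw [div_lt_iff₀ (by exact_mod_cast hK.card_pos), Set.ncard_eq_toFinset_card _ hfin] at hKb
  rw [hκ.escapeMass_eq h hθ, ← Finset.sum_sdiff hDK]
  have hout : ∀ v ∈ K \ D, μ {x | κ x v ∉ K} ≤ ENNReal.ofReal (ε / 2) := by
    intro v hv
    rw [Finset.mem_sdiff] at hv
    refine le_trans (measure_mono fun x hx => ?_) ((measure_iUnion_le
      (fun i : {i // i ∉ F} => α i)).trans hF.le)
    obtain ⟨i, hi⟩ := h.exists_mem_atom x
    refine Set.mem_iUnion.2 ⟨⟨i, fun hiF => hv.2 (hfin.mem_toFinset.2 ⟨hv.1, κ x v, hκ.adj x v, hx,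
      (hδ2 i hiF).trans_le (measureReal_mono fun y hy => ?_)⟩)⟩, hi⟩
    exact congrArg (fun σ : Equiv.Perm V => σ v) (hκ.const_on_atoms i y hy x hi)
  calc ∑ v ∈ K \ D, μ {x | κ x v ∉ K} + ∑ v ∈ D, μ {x | κ x v ∉ K}
      ≤ ∑ v ∈ K, ENNReal.ofReal (ε / 2) + ∑ v ∈ D, 1 := by
        refine add_le_add ((Finset.sum_le_sum hout).trans ?_)
          (Finset.sum_le_sum fun v _ => prob_le_one)
        exact Finset.sum_le_sum_of_subset Finset.sdiff_subset
    _ ≤ ENNReal.ofReal (ε / 2) * K.card + ENNReal.ofReal (ε / 2 * K.card) := by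
        refine add_le_add (by simp [mul_comm]) ?_
        rw [Finset.sum_const, nsmul_one, ← ENNReal.ofReal_natCast]
        exact ENNReal.ofReal_le_ofReal hKb.le
    _ = ENNReal.ofReal ε * K.card := by
        rw [ENNReal.ofReal_mul (by positivity), ENNReal.ofReal_natCast, ← add_mul,
          ← ENNReal.ofReal_add (by positivity) (by positivity), add_halves]

/-- The infimum vanishes for every `ε > 0`, not only in the limit. A vertex of the `ε`-boundary
loses mass at least `ε`, so, as in Chebyshev's inequality, escape mass at most `ε * δ` per vertex
leaves a boundary proportion of at most `δ`. -/
lemma HasFolnerSets.isMuAmenable [IsProbabilityMeasure μ]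
    (hκ : IsNearestNeighbourCocycle G α κ) (h : IsMarkovMap θ μ α) (hθ : Measurable θ)
    (ha : HasFolnerSets μ (extensionMap θ κ)) : IsMuAmenable G μ κ := by
  refine tendsto_const_nhds.congr' ?_
  filter_upwards [self_mem_nhdsWithin] with ε hε
  replace hε : 0 < ε := hε
  refine le_antisymm (Real.iInf_nonneg fun K => by positivity) ?_
  refine le_of_forall_pos_le_add fun δ hδ => ?_
  rw [zero_add]
  obtain ⟨A, hA, hAe⟩ := ha (ε * δ) (by positivity)
  refine (ciInf_le ⟨0, by rintro _ ⟨K, rfl⟩; positivity⟩ ⟨A, hA⟩).trans ?_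
  have hfin : (epsBoundary G (canonicalWeight μ κ) ε A).Finite :=
    A.finite_toSet.subset fun v hv => hv.1
  have hDA : hfin.toFinset ⊆ A := fun v hv => (hfin.mem_toFinset.1 hv).1
  have hAc : (0 : ℝ) < A.card := by exact_mod_cast hA.card_pos
  rw [div_le_iff₀ hAc, Set.ncard_eq_toFinset_card _ hfin]
  have key : ENNReal.ofReal (hfin.toFinset.card * ε) ≤ ENNReal.ofReal (ε * δ * A.card) := by
    calc ENNReal.ofReal (hfin.toFinset.card * ε)
        = ∑ v ∈ hfin.toFinset, ENNReal.ofReal ε := by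
          rw [Finset.sum_const, nsmul_eq_mul, ENNReal.ofReal_mul (by positivity),
            ENNReal.ofReal_natCast]
      _ ≤ ∑ v ∈ hfin.toFinset, μ {x | κ x v ∉ A} := by
          refine Finset.sum_le_sum fun v hv => ?_
          obtain ⟨-, u, -, huA, hu⟩ := hfin.mem_toFinset.1 hv
          calc ENNReal.ofReal ε ≤ ENNReal.ofReal (canonicalWeight μ κ v u) :=
                ENNReal.ofReal_le_ofReal hu.le
            _ = μ {x | κ x v = u} := ENNReal.ofReal_toReal (measure_ne_top _ _)
            _ ≤ _ := measure_mono fun x hx => by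
              rw [Set.mem_ofPred_eq] at hx ⊢
              rwa [hx]
      _ ≤ ∑ v ∈ A, μ {x | κ x v ∉ A} := Finset.sum_le_sum_of_subset hDA
      _ ≤ _ := by
          rw [← hκ.escapeMass_eq h hθ, ENNReal.ofReal_mul (by positivity),
            ENNReal.ofReal_natCast]
          exact hAe
  have := (ENNReal.ofReal_le_ofReal_iff (by positivity)).1 key
  have h3 : ε * hfin.toFinset.card ≤ ε * (δ * A.card) := by linarith
  exact le_of_mul_le_mul_left h3 hε

end Folner

/-! ### The transfer operator on indicators of `X × A` -/

section Indicators

variable {X ι V : Type*} [MeasurableSpace X] [MeasurableSpace V] [Countable V]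
  [DiscreteMeasurableSpace V] {θ : X → X} {μ : Measure X} {α : ι → Set X} {G : Digraph V}
  {κ : X → Equiv.Perm V} [IsProbabilityMeasure μ]

open Classical in
lemma fiberIndicator_apply (A : Finset V) (g : V) :
    fiberIndicator μ A g = if g ∈ A then Lp.const ∞ μ (1 : ℂ) else 0 := by
  rw [fiberIndicator, lp.coeFn_sum, Finset.sum_apply]
  simp only [lp.single_apply, Pi.single_apply]
  rw [Finset.sum_ite_eq]

open Classical in
lemma coeFn_fiberIndicator (A : Finset V) (g : V) :
    fiberIndicator μ A g =ᵐ[μ] fun _ => if g ∈ A then 1 else 0 := by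
  rw [fiberIndicator_apply]
  split_ifs
  · exact Lp.coeFn_const _ _ _
  · exact Lp.coeFn_zero _ _ _

open Classical in
lemma norm_fiberIndicator_apply (A : Finset V) (g : V) :
    ‖fiberIndicator μ A g‖ = if g ∈ A then 1 else 0 := by
  rw [fiberIndicator_apply]
  split_ifs
  · simp [Lp.norm_const]
  · simp

lemma norm_fiberIndicator_sq (A : Finset V) : ‖fiberIndicator μ A‖ ^ 2 = A.card := by
  classical
  rw [norm_sq_eq_tsum]
  simp only [norm_fiberIndicator_apply]
  rw [tsum_eq_sum (s := A) fun g hg => by simp [hg]]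
  simp

lemma toFun_fiberIndicator (A : Finset V) : ∀ᵐ p ∂(μ.prod Measure.count),
    toFun (fiberIndicator μ A) p = (fiberSet X A).indicator (fun _ => 1) p := by
  classical
  refine ae_prod_count (P := fun x g => fiberIndicator μ A g x =
    (fiberSet X A).indicator (fun _ => 1) (x, g)) fun g => ?_
  filter_upwards [coeFn_fiberIndicator A g] with x hx
  rw [hx]
  simp [Set.indicator_apply, fiberSet]

lemma integral_toFun_fiberIndicator_mul {S : X × V → X × V} (hS : Measurable S) (A : Finset V)
    {s : Set (X × V)} (hs : MeasurableSet s) :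
    ∫ p, toFun (fiberIndicator μ A) p * s.indicator (fun _ => 1) (S p) ∂(μ.prod Measure.count) =
      ((μ.prod Measure.count).real (fiberSet X A ∩ S ⁻¹' s) : ℂ) := by
  have h : ∀ᵐ p ∂(μ.prod Measure.count), toFun (fiberIndicator μ A) p *
      s.indicator (fun _ => 1) (S p) = (fiberSet X A ∩ S ⁻¹' s).indicator (fun _ => (1 : ℂ)) p := by
    filter_upwards [toFun_fiberIndicator A] with p hp
    rw [hp]
    by_cases h1 : p ∈ fiberSet X A <;> by_cases h2 : S p ∈ s <;> simp [h1, h2]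
  rw [integral_congr_ae h, integral_indicator ((measurableSet_fiberSet A).inter (hS hs)),
    setIntegral_const]
  simp

/-- The push forward under `θ` of the restriction of `μ` to the points moving `A` to `g`. -/
def arrivalMeasure (θ : X → X) (μ : Measure X) (κ : X → Equiv.Perm V) (A : Finset V) (g : V) :
    Measure X :=
  (μ.restrict {x | (κ x)⁻¹ g ∈ A}).map θ

lemma arrivalMeasure_le (hinv : MeasurePreserving θ μ μ) (A : Finset V) (g : V) :
    arrivalMeasure θ μ κ A g ≤ μ :=
  (Measure.map_mono Measure.restrict_le_self hinv.measurable).trans_eq hinv.map_eq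

lemma arrivalMeasure_univ (hinv : MeasurePreserving θ μ μ) (A : Finset V) (g : V) :
    arrivalMeasure θ μ κ A g Set.univ = μ {x | (κ x)⁻¹ g ∈ A} := by
  rw [arrivalMeasure, Measure.map_apply hinv.measurable MeasurableSet.univ]
  simp

instance (A : Finset V) (g : V) : IsFiniteMeasure (arrivalMeasure θ μ κ A g) := by
  unfold arrivalMeasure; infer_instance

variable [Countable ι]

lemma measure_fiberSet_inter_preimage (hκ : IsNearestNeighbourCocycle G α κ)
    (h : IsMarkovMap θ μ α) (hinv : MeasurePreserving θ μ μ) (A : Finset V) {B : Set X}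
    (hB : MeasurableSet B) (g : V) :
    μ.prod Measure.count (fiberSet X A ∩ extensionMap θ κ ⁻¹' (B ×ˢ {g})) =
      arrivalMeasure θ μ κ A g B := by
  rw [measure_prod_count ((measurableSet_fiberSet A).inter
    (hκ.measurable_extensionMap h hinv.measurable (hB.prod (measurableSet_singleton g)))),
    arrivalMeasure, Measure.map_apply hinv.measurable hB,
    Measure.restrict_apply (hinv.measurable hB), ← measure_iUnion]
  · congr 1
    ext x
    simp only [fiberSet, extensionMap, Set.mem_iUnion, Set.mem_inter_iff, Set.mem_preimage,
      Set.mem_ofPred_eq, Set.mem_prod, Set.mem_singleton_iff]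
    constructor
    · rintro ⟨v, hv, hx, rfl⟩
      exact ⟨hx, by simpa using hv⟩
    · rintro ⟨hx, hv⟩
      exact ⟨_, hv, hx, by simp⟩
  · intro v v' hv
    refine Set.disjoint_left.2 fun x hx hx' => hv ?_
    exact (κ x).injective (hx.2.2.trans hx'.2.2.symm)
  · intro v
    have := hκ.measurableSet_setOf h fun σ => v ∈ A ∧ σ v = g
    convert this.inter (hinv.measurable hB) using 1
    ext x
    simp [fiberSet, extensionMap]
    tauto

/-- Testing against the indicators of `B × {g}` identifies the fiber over `g` with a Radon–Nikodym
derivative. It is at most `1`, as the arrival measure is dominated by `μ`. -/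
lemma IsTransferOperator.apply_fiberIndicator (hκ : IsNearestNeighbourCocycle G α κ)
    (h : IsMarkovMap θ μ α) (hinv : MeasurePreserving θ μ μ)
    {L : HInfty μ V →L[ℂ] HInfty μ V} (hL : IsTransferOperator (extensionMap θ κ) L)
    (A : Finset V) (g : V) :
    L (fiberIndicator μ A) g =ᵐ[μ]
      fun x => (((arrivalMeasure θ μ κ A g).rnDeriv μ x).toReal : ℂ) := by
  refine (Lp.integrable_top _).ae_eq_of_forall_setIntegral_eq _ _
    (Measure.integrable_toReal_rnDeriv.ofReal) fun B hB _ => ?_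
  have hi : Integrable ((B ×ˢ {g}).indicator fun _ => (1 : ℂ)) (μ.prod Measure.count) := by
    refine integrable_indicator_one (hB.prod (measurableSet_singleton g)) ?_
    rw [prod_count_singleton]
    exact measure_ne_top μ B
  rw [← integral_toFun_mul_indicator _ hB, hL _ _ hi, integral_toFun_fiberIndicator_mul
    (hκ.measurable_extensionMap h hinv.measurable) _ (hB.prod (measurableSet_singleton g)),
    Measure.real, measure_fiberSet_inter_preimage hκ h hinv _ hB, integral_complex_ofReal,
    Measure.setIntegral_toReal_rnDeriv
      (Measure.absolutelyContinuous_of_le (arrivalMeasure_le hinv A g))]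
  rfl

open Classical in
/-- The `L¹`-norm of `T̂ 1_{X × A} - 1_{X × A}` on the fiber over `g`. -/
def fiberDefect (μ : Measure X) (κ : X → Equiv.Perm V) (A : Finset V) (g : V) : ℝ≥0∞ :=
  if g ∈ A then μ {x | (κ x)⁻¹ g ∉ A} else μ {x | (κ x)⁻¹ g ∈ A}

lemma fiberDefect_le_one (A : Finset V) (g : V) : fiberDefect μ κ A g ≤ 1 := by
  unfold fiberDefect
  split_ifs <;> exact prob_le_one

open Classical in
-- The density `ρ` has values in `[0, 1]`, so the difference has constant sign on each fiber: its
-- modulus is `1 - ρ` over `A` and `ρ` elsewhere. The `L¹` norm is therefore a difference of masses.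
lemma IsTransferOperator.lintegral_defect (hκ : IsNearestNeighbourCocycle G α κ)
    (h : IsMarkovMap θ μ α) (hinv : MeasurePreserving θ μ μ)
    {L : HInfty μ V →L[ℂ] HInfty μ V} (hL : IsTransferOperator (extensionMap θ κ) L)
    (A : Finset V) (g : V) :
    ∫⁻ x, ‖L (fiberIndicator μ A) g x - fiberIndicator μ A g x‖ₑ ∂μ = fiberDefect μ κ A g := by
  set ρ := (arrivalMeasure θ μ κ A g).rnDeriv μ with hρ
  have hρ1 : ρ ≤ᵐ[μ] 1 := Measure.rnDeriv_le_one_of_le (arrivalMeasure_le hinv A g)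
  have hρm : Measurable ρ := Measure.measurable_rnDeriv _ _
  have hρi : ∫⁻ x, ρ x ∂μ = μ {x | (κ x)⁻¹ g ∈ A} := by
    rw [hρ, Measure.lintegral_rnDeriv
      (Measure.absolutelyContinuous_of_le (arrivalMeasure_le hinv A g)), arrivalMeasure_univ hinv]
  have hcongr : ∀ᵐ x ∂μ, ‖L (fiberIndicator μ A) g x - fiberIndicator μ A g x‖ₑ =
      if g ∈ A then 1 - ρ x else ρ x := by
    filter_upwards [hL.apply_fiberIndicator hκ h hinv A g, coeFn_fiberIndicator A g, hρ1]
      with x h1 h2 h3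
    have h3' : ρ x ≤ 1 := h3
    have hfin : ρ x ≠ ∞ := (h3'.trans_lt ENNReal.one_lt_top).ne
    rw [h1, h2]
    split_ifs
    · rw [enorm_sub_rev, ← Complex.ofReal_one, ← Complex.ofReal_sub, ← ofReal_norm,
        Complex.norm_real, ← ENNReal.toReal_one, ← ENNReal.toReal_sub_of_le h3' ENNReal.one_ne_top,
        Real.norm_of_nonneg ENNReal.toReal_nonneg, ENNReal.ofReal_toReal (by simp)]
    · rw [sub_zero, ← ofReal_norm, Complex.norm_real,
        Real.norm_of_nonneg ENNReal.toReal_nonneg, ENNReal.ofReal_toReal hfin]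
  rw [lintegral_congr_ae hcongr, fiberDefect]
  split_ifs
  · refine (lintegral_sub (f := fun _ => 1) hρm (by rw [hρi]; exact measure_ne_top _ _)
      hρ1).trans ?_
    rw [hρi]
    have := prob_compl_eq_one_sub (μ := μ) (hκ.measurableSet_setOf h fun σ => σ⁻¹ g ∈ A)
    simp only [lintegral_one, measure_univ]
    exact this.symm
  · exact hρi

lemma measure_inv_mem_eq_sum (hκ : IsNearestNeighbourCocycle G α κ) (h : IsMarkovMap θ μ α)
    (A : Finset V) (g : V) :
    μ {x | (κ x)⁻¹ g ∈ A} = ∑ v ∈ A, μ {x | κ x v = g} := by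
  rw [← measure_biUnion_finset]
  · congr 1
    ext x
    simp only [Set.mem_ofPred_eq, Set.mem_iUnion, exists_prop]
    constructor
    · intro hx
      exact ⟨_, hx, by simp⟩
    · rintro ⟨v, hv, rfl⟩
      simpa using hv
  · intro v _ v' _ hv
    exact Set.disjoint_left.2 fun x hx hx' => hv ((κ x).injective (hx.trans hx'.symm))
  · exact fun v _ => hκ.measurableSet_setOf h fun σ => σ v = g

lemma measure_mem_eq_sum (hκ : IsNearestNeighbourCocycle G α κ) (h : IsMarkovMap θ μ α)
    (A : Finset V) (v : V) :
    μ {x | κ x v ∈ A} = ∑ g ∈ A, μ {x | κ x v = g} := by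
  rw [← measure_biUnion_finset]
  · congr 1
    ext x
    simp
  · intro g _ g' _ hg
    exact Set.disjoint_left.2 fun x hx hx' => hg (hx.symm.trans hx')
  · exact fun g _ => hκ.measurableSet_setOf h fun σ => σ v = g

/-- Conservation of mass: since each `κ x` is a bijection, the mass entering `A` from outside equals
the mass leaving `A`. Adding the mass `P` that moves within `A` gives `#A` in both cases. -/
lemma sum_fiberDefect (hκ : IsNearestNeighbourCocycle G α κ) (h : IsMarkovMap θ μ α)
    (hθ : Measurable θ) (A : Finset V) :
    ∑ g ∈ A, fiberDefect μ κ A g = escapeMass μ (extensionMap θ κ) A := by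
  rw [hκ.escapeMass_eq h hθ]
  set P := ∑ g ∈ A, ∑ v ∈ A, μ {x | κ x v = g} with hP
  have hPfin : P ≠ ∞ := by simp [hP]
  have h1 : ∑ g ∈ A, fiberDefect μ κ A g + P = A.card := by
    rw [hP, ← Finset.sum_add_distrib, Finset.card_eq_sum_ones, Nat.cast_sum]
    refine Finset.sum_congr rfl fun g hg => ?_
    rw [← measure_inv_mem_eq_sum hκ h, fiberDefect, if_pos hg, add_comm]
    rw [Nat.cast_one]
    exact prob_add_prob_compl (μ := μ) (hκ.measurableSet_setOf h fun σ => σ⁻¹ g ∈ A)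
  have h2 : ∑ v ∈ A, μ {x | κ x v ∉ A} + P = A.card := by
    rw [hP, Finset.sum_comm, ← Finset.sum_add_distrib, Finset.card_eq_sum_ones, Nat.cast_sum]
    refine Finset.sum_congr rfl fun v hv => ?_
    rw [← measure_mem_eq_sum hκ h, add_comm]
    rw [Nat.cast_one]
    exact prob_add_prob_compl (μ := μ) (hκ.measurableSet_setOf h fun σ => σ v ∈ A)
  exact (ENNReal.add_left_inj hPfin).1 (h1.trans h2.symm)

open Classical in
-- The fibers over `A` record the missing incoming mass, the others record where the escaping mass
-- lands. Each part contributes one escape mass.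
lemma tsum_fiberDefect (hκ : IsNearestNeighbourCocycle G α κ) (h : IsMarkovMap θ μ α)
    (hθ : Measurable θ) (A : Finset V) :
    ∑' g, fiberDefect μ κ A g = 2 * escapeMass μ (extensionMap θ κ) A := by
  have h1 : ∑' g, (if g ∈ A then fiberDefect μ κ A g else 0) =
      escapeMass μ (extensionMap θ κ) A := by
    rw [tsum_eq_sum (s := A) fun g hg => if_neg hg, ← sum_fiberDefect hκ h hθ]
    exact Finset.sum_congr rfl fun g hg => if_pos hg
  have h2 : ∑' g, (if g ∈ A then 0 else fiberDefect μ κ A g) =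
      escapeMass μ (extensionMap θ κ) A := by
    rw [hκ.escapeMass_eq h hθ]
    calc ∑' g, (if g ∈ A then 0 else fiberDefect μ κ A g)
        = ∑' g, ∑ v ∈ A, μ {x | κ x v = g ∧ g ∉ A} := by
          refine tsum_congr fun g => ?_
          split_ifs with hg
          · simp [hg]
          · simp only [fiberDefect, ↓reduceIte, measure_inv_mem_eq_sum hκ h, hg, not_false_eq_true,
              and_true]
      _ = ∑ v ∈ A, ∑' g, μ {x | κ x v = g ∧ g ∉ A} :=
          Summable.tsum_finsetSum fun _ _ => ENNReal.summable
      _ = _ := by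
          refine Finset.sum_congr rfl fun v _ => ?_
          rw [← measure_iUnion]
          · congr 1
            ext x
            simp
          · intro g g' hg
            exact Set.disjoint_left.2 fun x hx hx' => hg (hx.1.symm.trans hx'.1)
          · exact fun g => hκ.measurableSet_setOf h fun σ => σ v = g ∧ g ∉ A
  rw [two_mul]
  nth_rewrite 1 [← h1]
  rw [← h2, ← ENNReal.tsum_add]
  refine tsum_congr fun g => ?_
  split_ifs <;> simp

lemma IsTransferOperator.lintegral_prod_defect (hκ : IsNearestNeighbourCocycle G α κ)
    (h : IsMarkovMap θ μ α) (hinv : MeasurePreserving θ μ μ)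
    {L : HInfty μ V →L[ℂ] HInfty μ V} (hL : IsTransferOperator (extensionMap θ κ) L)
    (A : Finset V) :
    ∫⁻ p, ‖toFun (L (fiberIndicator μ A)) p - toFun (fiberIndicator μ A) p‖ₑ
      ∂(μ.prod Measure.count) = 2 * escapeMass μ (extensionMap θ κ) A := by
  rw [lintegral_prod_count (f := fun p => ‖toFun (L (fiberIndicator μ A)) p -
      toFun (fiberIndicator μ A) p‖ₑ) ((measurable_toFun _).sub (measurable_toFun _)).enorm,
    ← tsum_fiberDefect hκ h hinv.measurable]
  exact tsum_congr fun g => hL.lintegral_defect hκ h hinv A g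

lemma IsTransferOperator.norm1_defect (hκ : IsNearestNeighbourCocycle G α κ)
    (h : IsMarkovMap θ μ α) (hinv : MeasurePreserving θ μ μ)
    {L : HInfty μ V →L[ℂ] HInfty μ V} (hL : IsTransferOperator (extensionMap θ κ) L)
    (A : Finset V) :
    norm1 (L (fiberIndicator μ A) - fiberIndicator μ A) =
      (∑' g, fiberDefect μ κ A g ^ 2) ^ (1 / 2 : ℝ) := by
  rw [norm1]
  congr 1
  refine tsum_congr fun g => ?_
  rw [← hL.lintegral_defect hκ h hinv A g, eLpNorm_one_eq_lintegral_enorm]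
  congr 1
  refine lintegral_congr_ae ?_
  filter_upwards [Lp.coeFn_sub (L (fiberIndicator μ A) g) (fiberIndicator μ A g)] with x hx
  rw [lp.coeFn_sub, Pi.sub_apply, hx, Pi.sub_apply]

lemma norm1_fiberIndicator (A : Finset V) :
    norm1 (fiberIndicator μ A) = (A.card : ℝ≥0∞) ^ (1 / 2 : ℝ) := by
  classical
  rw [norm1]
  congr 1
  have : ∀ g, eLpNorm (fiberIndicator μ A g) 1 μ ^ 2 = if g ∈ A then 1 else 0 := fun g => by
    rw [eLpNorm_congr_ae (coeFn_fiberIndicator A g)]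
    split_ifs <;> simp [eLpNorm_one_eq_lintegral_enorm]
  rw [tsum_congr this, tsum_eq_sum (s := A) fun g hg => if_neg hg]
  simp

end Indicators

/-! ### Conditions 3 and 4 in terms of Følner sets -/

section AlmostInvariantIndicators

variable {X ι V : Type*} [MeasurableSpace X] [MeasurableSpace V] [Countable V]
  [DiscreteMeasurableSpace V] {θ : X → X} {μ : Measure X} {α : ι → Set X} {G : Digraph V}
  {κ : X → Equiv.Perm V} [IsProbabilityMeasure μ] [Countable ι]
  {L : HInfty μ V →L[ℂ] HInfty μ V}

lemma hasFolnerSets_iff_lintegral (hκ : IsNearestNeighbourCocycle G α κ)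
    (h : IsMarkovMap θ μ α) (hinv : MeasurePreserving θ μ μ)
    (hL : IsTransferOperator (extensionMap θ κ) L) :
    HasFolnerSets μ (extensionMap θ κ) ↔
      ∀ ε : ℝ, 0 < ε → ∃ A : Finset V, A.Nonempty ∧
        ∫⁻ p, ‖toFun (L (fiberIndicator μ A)) p - toFun (fiberIndicator μ A) p‖ₑ
          ∂(μ.prod Measure.count) ≤ ENNReal.ofReal ε * (A.card : ℝ≥0∞) := by
  simp only [hL.lintegral_prod_defect hκ h hinv]
  constructor
  · intro H ε hε
    obtain ⟨A, hA, hAe⟩ := H (ε / 2) (by positivity)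
    refine ⟨A, hA, (mul_le_mul_right hAe 2).trans_eq ?_⟩
    rw [← mul_assoc, ← ENNReal.ofReal_ofNat, ← ENNReal.ofReal_mul (by norm_num),
      mul_div_cancel₀ _ two_ne_zero]
  · intro H ε hε
    obtain ⟨A, hA, hAe⟩ := H ε hε
    exact ⟨A, hA, (le_mul_of_one_le_left' (by norm_num)).trans hAe⟩

lemma ENNReal.rpow_half_le_mul_rpow_half_iff {a b c : ℝ≥0∞} :
    a ^ (1 / 2 : ℝ) ≤ b * c ^ (1 / 2 : ℝ) ↔ a ≤ b ^ 2 * c := by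
  have hb : b = (b ^ 2) ^ (1 / 2 : ℝ) := by
    rw [← ENNReal.rpow_natCast, ← ENNReal.rpow_mul]
    norm_num
  rw [hb, ← ENNReal.mul_rpow_of_nonneg _ _ (by norm_num), ← hb,
    ENNReal.rpow_le_rpow_iff (by norm_num)]

lemma ENNReal.le_add_inv_mul_sq {a c : ℝ≥0∞} (hc : c ≠ 0) (hc' : c ≠ ∞) :
    a ≤ c + c⁻¹ * a ^ 2 := by
  rcases le_total a c with h | h
  · exact h.trans le_self_add
  · calc a = c⁻¹ * (c * a) := by rw [← mul_assoc, ENNReal.inv_mul_cancel hc hc', one_mul]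
      _ ≤ c⁻¹ * a ^ 2 := by rw [sq]; gcongr
      _ ≤ _ := le_add_self

/-- Defects `d` are at most `1`, so `d² ≤ d` and the `ℓ¹` bound controls the `ℓ²` bound. Conversely
`d ≤ c + d² / c`, and it suffices to sum this over the finite set `A`, because the defects there
already add up to the escape mass. -/
lemma hasFolnerSets_iff_norm1 (hκ : IsNearestNeighbourCocycle G α κ)
    (h : IsMarkovMap θ μ α) (hinv : MeasurePreserving θ μ μ)
    (hL : IsTransferOperator (extensionMap θ κ) L) :
    HasFolnerSets μ (extensionMap θ κ) ↔
      ∀ ε : ℝ, 0 < ε → ∃ A : Finset V, A.Nonempty ∧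
        norm1 (L (fiberIndicator μ A) - fiberIndicator μ A) ≤
          ENNReal.ofReal ε * norm1 (fiberIndicator μ A) := by
  simp only [hL.norm1_defect hκ h hinv, norm1_fiberIndicator,
    ENNReal.rpow_half_le_mul_rpow_half_iff]
  constructor
  · intro H ε hε
    obtain ⟨A, hA, hAe⟩ := H (ε ^ 2 / 2) (by positivity)
    refine ⟨A, hA, ?_⟩
    calc ∑' g, fiberDefect μ κ A g ^ 2 ≤ ∑' g, fiberDefect μ κ A g :=
          ENNReal.tsum_le_tsum fun g => by
            rw [sq]
            exact mul_le_of_le_one_left' (fiberDefect_le_one A g)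
      _ = 2 * escapeMass μ (extensionMap θ κ) A := tsum_fiberDefect hκ h hinv.measurable A
      _ ≤ 2 * (ENNReal.ofReal (ε ^ 2 / 2) * A.card) := by gcongr
      _ = _ := by
          rw [← mul_assoc, ← ENNReal.ofReal_ofNat, ← ENNReal.ofReal_mul (by norm_num),
            mul_div_cancel₀ _ two_ne_zero, ENNReal.ofReal_pow hε.le]
  · intro H ε hε
    obtain ⟨A, hA, hAe⟩ := H (ε / 2) (by positivity)
    refine ⟨A, hA, ?_⟩
    set c := ENNReal.ofReal (ε / 2)
    have hc : c ≠ 0 := (ENNReal.ofReal_pos.2 (by positivity)).ne'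
    have hc' : c ≠ ∞ := ENNReal.ofReal_ne_top
    calc escapeMass μ (extensionMap θ κ) A = ∑ g ∈ A, fiberDefect μ κ A g :=
          (sum_fiberDefect hκ h hinv.measurable A).symm
      _ ≤ ∑ g ∈ A, (c + c⁻¹ * fiberDefect μ κ A g ^ 2) :=
          Finset.sum_le_sum fun g _ => ENNReal.le_add_inv_mul_sq hc hc'
      _ = c * A.card + c⁻¹ * ∑ g ∈ A, fiberDefect μ κ A g ^ 2 := by
          rw [Finset.sum_add_distrib, Finset.sum_const, nsmul_eq_mul, mul_comm, Finset.mul_sum]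
      _ ≤ c * A.card + c⁻¹ * (c ^ 2 * A.card) := by
          gcongr
          exact (ENNReal.sum_le_tsum A).trans hAe
      _ = ENNReal.ofReal ε * A.card := by
          rw [← mul_assoc, sq, ← mul_assoc c⁻¹, ENNReal.inv_mul_cancel hc hc', one_mul, ← add_mul,
            ← ENNReal.ofReal_add (by positivity) (by positivity), add_halves]

end AlmostInvariantIndicators

/-! ### Norms of powers and the spectral radius -/

section SpectralRadius

variable {X V : Type*} [MeasurableSpace X] [MeasurableSpace V] [Countable V]
  [DiscreteMeasurableSpace V] {μ : Measure X} [IsProbabilityMeasure μ]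
  {L : HInfty μ V →L[ℂ] HInfty μ V}

/-- Cauchy–Schwarz over the `#A` fibers that contribute. -/
lemma norm_integral_fiberSet_le (f : HInfty μ V) (A : Finset V) :
    ‖∫ p, toFun f p * (fiberSet X A).indicator (fun _ => 1) p ∂(μ.prod Measure.count)‖ ^ 2 ≤
      A.card * ‖f‖ ^ 2 := by
  have hi := integrable_indicator_one (μ := μ) (measurableSet_fiberSet (X := X) A)
    (by rw [measure_fiberSet]; exact ENNReal.natCast_ne_top _)
  have h0 : ∀ g ∉ A, ∫ x, toFun f (x, g) * (fiberSet X A).indicator (fun _ => 1) (x, g) ∂μ = 0 := by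
    intro g hg
    simp [fiberSet, hg]
  have h1 : ∀ g ∈ A, ‖∫ x, toFun f (x, g) * (fiberSet X A).indicator (fun _ => 1) (x, g) ∂μ‖ ≤
      ‖f g‖ := by
    intro g hg
    refine (norm_integral_le_of_norm_le_const (C := ‖f g‖) ?_).trans (by simp)
    filter_upwards [Lp.ae_norm_le_norm_top (f g)] with x hx
    simpa [fiberSet, hg, toFun] using hx
  rw [integral_prod_count (integrable_toFun_mul f hi), tsum_eq_sum (s := A) fun g hg => h0 g hg]
  calc _ ≤ (∑ g ∈ A, ‖f g‖) ^ 2 := by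
        gcongr
        exact (norm_sum_le _ _).trans (Finset.sum_le_sum h1)
    _ ≤ A.card * ∑ g ∈ A, ‖f g‖ ^ 2 := sq_sum_le_card_mul_sum_sq
    _ ≤ _ := by
        rw [norm_sq_eq_tsum]
        gcongr
        exact (summable_norm_sq f).sum_le_tsum A fun g _ => by positivity

/-- The pairing of `Lⁿ 1_{X × A}` with `1_{X × A}` is the mass that is in `X × A` at times `0` and
`n`, at least `(1 - ε) #A`. By Cauchy–Schwarz it is at most `‖Lⁿ‖ #A`. -/
lemma HasFolnerSets.one_le_norm_pow {S : X × V → X × V}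
    (hS : MeasurePreserving S (μ.prod Measure.count) (μ.prod Measure.count))
    (hF : HasFolnerSets μ S) (hL : IsTransferOperator S L) (n : ℕ) : 1 ≤ ‖L ^ n‖ := by
  refine le_of_forall_pos_le_add fun ε hε => ?_
  -- The escape mass is paid `n` times; the `+ 1` only avoids division by zero.
  obtain ⟨A, hA, hAe⟩ := hF (ε / (n + 1)) (by positivity)
  have hB := measurableSet_fiberSet (X := X) A
  have hfin : μ.prod Measure.count (fiberSet X A) ≠ ∞ := by
    rw [measure_fiberSet]; exact ENNReal.natCast_ne_top _
  have hi := integrable_indicator_one (μ := μ) hB hfin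
  have hc : (0 : ℝ) < A.card := by exact_mod_cast hA.card_pos
  have h1 := norm_integral_fiberSet_le ((L ^ n) (fiberIndicator μ A)) A
  rw [(hL.pow hS n) _ _ hi, integral_toFun_fiberIndicator_mul (hS.measurable.iterate n) A hB,
    Complex.norm_real, Real.norm_of_nonneg measureReal_nonneg] at h1
  have h2 : (μ.prod Measure.count).real (fiberSet X A \ S^[n] ⁻¹' fiberSet X A) ≤
      ε * A.card := by
    have h3 : μ.prod Measure.count (fiberSet X A \ S^[n] ⁻¹' fiberSet X A) ≤
        ENNReal.ofReal (ε * A.card) := by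
      calc _ ≤ n * escapeMass μ S A := measure_fiberSet_diff_iterate_le hS A n
        _ ≤ n * (ENNReal.ofReal (ε / (n + 1)) * A.card) := by gcongr
        _ = ENNReal.ofReal (n * (ε / (n + 1) * A.card)) := by
            rw [ENNReal.ofReal_mul (by positivity), ENNReal.ofReal_mul (by positivity),
              ENNReal.ofReal_natCast, ENNReal.ofReal_natCast]
        _ ≤ _ := by
            refine ENNReal.ofReal_le_ofReal ?_
            rw [← mul_assoc, mul_div_assoc']
            gcongr
            rw [div_le_iff₀ (by positivity)]
            nlinarith
    exact (ENNReal.toReal_mono ENNReal.ofReal_ne_top h3).trans_eq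
      (ENNReal.toReal_ofReal (by positivity))
  have h4 := measureReal_inter_add_sdiff (μ := μ.prod Measure.count) (s := fiberSet X A)
    (hS.measurable.iterate n hB) hfin
  have h5 : (μ.prod Measure.count).real (fiberSet X A) = A.card := by
    rw [Measure.real, measure_fiberSet]; simp
  have h6 : ‖(L ^ n) (fiberIndicator μ A)‖ ^ 2 ≤ ‖L ^ n‖ ^ 2 * A.card := by
    rw [← norm_fiberIndicator_sq (μ := μ), ← mul_pow]
    gcongr
    exact (L ^ n).le_opNorm _
  have h7 : (μ.prod Measure.count).real (fiberSet X A ∩ S^[n] ⁻¹' fiberSet X A) ≤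
      A.card * ‖L ^ n‖ := by
    refine (sq_le_sq₀ measureReal_nonneg (by positivity)).1 (h1.trans ?_)
    rw [mul_pow, sq (A.card : ℝ), mul_assoc, mul_comm (A.card : ℝ) (‖L ^ n‖ ^ 2)]
    gcongr
  rw [h5] at h4
  have h8 : (A.card : ℝ) * 1 ≤ A.card * (‖L ^ n‖ + ε) := by linarith
  exact le_of_mul_le_mul_left h8 hc

variable {E : Type*} [NormedAddCommGroup E] [NormedSpace ℂ E] [CompleteSpace E]

lemma spectralRadius_eq_one_of_norm_pow_bounded {L : E →L[ℂ] E} {K : ℝ}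
    (h1 : ∀ n, 1 ≤ ‖L ^ n‖) (h2 : ∀ n, ‖L ^ n‖ ≤ K) : spectralRadius ℂ L = 1 := by
  have hK : 0 < K := one_pos.trans_le ((h1 0).trans (h2 0))
  have hlim := spectrum.pow_norm_pow_one_div_tendsto_nhds_spectralRadius L
  have hlim1 : Tendsto (fun n : ℕ => ‖L ^ n‖ ^ (1 / n : ℝ)) atTop (𝓝 1) := by
    have hK1 : Tendsto (fun n : ℕ => K ^ (1 / n : ℝ)) atTop (𝓝 1) := by
      have := ((Real.continuousAt_const_rpow (b := 0) hK.ne').tendsto).comp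
        tendsto_one_div_atTop_nhds_zero_nat
      simpa [Function.comp_def] using this
    refine tendsto_of_tendsto_of_tendsto_of_le_of_le tendsto_const_nhds hK1 (fun n => ?_)
      fun n => ?_
    · exact Real.one_le_rpow (h1 n) (by positivity)
    · exact Real.rpow_le_rpow (norm_nonneg _) (h2 n) (by positivity)
  have := tendsto_nhds_unique hlim ((ENNReal.continuous_ofReal.tendsto _).comp hlim1)
  simpa using this

/-- The spectral radius is bounded by the `(n + 1)`-th root of the norm of the `(n + 1)`-th power,
so one power of norm less than `1` would make it less than `1`. -/
lemma one_le_norm_pow_of_spectralRadius_eq_one {L : E →L[ℂ] E} (h : spectralRadius ℂ L = 1)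
    (n : ℕ) : 1 ≤ ‖L ^ (n + 1)‖ := by
  by_contra! hlt
  have h1 := spectrum.spectralRadius_le_pow_nnnorm_pow_one_div ℂ L n
  rw [h] at h1
  have h2 : (‖L ^ (n + 1)‖₊ : ℝ≥0∞) ^ (1 / (n + 1) : ℝ) < 1 :=
    ENNReal.rpow_lt_one (by exact_mod_cast hlt) (by positivity)
  have h3 : (‖(1 : E →L[ℂ] E)‖₊ : ℝ≥0∞) ^ (1 / (n + 1) : ℝ) ≤ 1 :=
    ENNReal.rpow_le_one (by exact_mod_cast ContinuousLinearMap.norm_id_le) (by positivity)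
  exact absurd (h1.trans (mul_le_of_le_one_right' h3)) (not_le.2 h2)

lemma exists_half_norm_lt_of_spectralRadius_eq_one {L : E →L[ℂ] E} (h : spectralRadius ℂ L = 1)
    (n : ℕ) : ∃ f, 1 / 2 * ‖f‖ < ‖(L ^ (n + 1)) f‖ := by
  by_contra! H
  have := (L ^ (n + 1)).opNorm_le_bound (by norm_num) H
  linarith [one_le_norm_pow_of_spectralRadius_eq_one h n]

end SpectralRadius

/-! ### Quadratic inequalities in `ℝ≥0∞` -/

section ENNRealInequalities

open scoped NNReal

lemma ENNReal.two_mul_mul_le (a b : ℝ≥0∞) {c : ℝ≥0} (hc : c ≠ 0) :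
    2 * (a * b) ≤ (c⁻¹ : ℝ≥0) * a ^ 2 + c * b ^ 2 := by
  rcases eq_or_ne a ∞ with rfl | ha
  · simp [hc]
  rcases eq_or_ne b ∞ with rfl | hb
  · simp [hc]
  lift a to ℝ≥0 using ha
  lift b to ℝ≥0 using hb
  norm_cast
  rw [← NNReal.coe_le_coe]
  push_cast
  have hc' : (0 : ℝ) < c := by positivity
  have h : (c : ℝ) * (c : ℝ)⁻¹ = 1 := mul_inv_cancel₀ hc'.ne'
  have h1 : (c : ℝ)⁻¹ * a ^ 2 + c * b ^ 2 - 2 * (a * b) = c * ((c : ℝ)⁻¹ * a - b) ^ 2 := by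
    field_simp
    ring
  nlinarith [mul_nonneg hc'.le (sq_nonneg ((c : ℝ)⁻¹ * a - b))]

lemma ENNReal.two_mul_mul_le_add_sq (a b : ℝ≥0∞) : 2 * (a * b) ≤ a ^ 2 + b ^ 2 := by
  simpa using ENNReal.two_mul_mul_le a b one_ne_zero

/-- Write `a² - b² = (a - b)(a + b)`, bound twice this product by `s (a - b)² + s⁻¹ (a + b)²`, and
use `(a + b)² ≤ 2 (a² + b²)`. The cross term of `(a - b)²` goes to the left, because subtraction in
`ℝ≥0∞` is truncated. -/
lemma ENNReal.two_mul_sq_sub_sq_add_le (a b : ℝ≥0∞) {s : ℝ≥0} (hs : s ≠ 0) :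
    2 * (a ^ 2 - b ^ 2) + 2 * s * (a * b) ≤ (s + 2 * (s⁻¹ : ℝ≥0)) * (a ^ 2 + b ^ 2) := by
  rcases eq_or_ne a ∞ with rfl | ha
  · simp [hs]
  rcases eq_or_ne b ∞ with rfl | hb
  · simp [hs]
  lift a to ℝ≥0 using ha
  lift b to ℝ≥0 using hb
  have hs' : (0 : ℝ) < s := by positivity
  have key : (s + 2 * (s : ℝ)⁻¹) * (a ^ 2 + b ^ 2) - 2 * (a ^ 2 - b ^ 2) - 2 * s * (a * b) =
      s * (a - b - (s : ℝ)⁻¹ * (a + b)) ^ 2 + (s : ℝ)⁻¹ * (a - b) ^ 2 := by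
    field_simp
    ring
  have h0 : 0 ≤ s * (a - b - (s : ℝ)⁻¹ * (a + b)) ^ 2 + (s : ℝ)⁻¹ * (a - b) ^ 2 := by positivity
  have h1 : 0 ≤ s * ((a : ℝ) - b) ^ 2 + 2 * (s : ℝ)⁻¹ * (a ^ 2 + b ^ 2) := by positivity
  norm_cast
  rw [← NNReal.coe_le_coe]
  rcases le_total (a ^ 2) (b ^ 2) with h | h
  · rw [tsub_eq_zero_of_le h]
    push_cast
    nlinarith
  · push_cast [NNReal.coe_sub h]
    nlinarith

/-- Jensen's inequality, from `2 Uᵢ Uⱼ ≤ Uᵢ² + Uⱼ²` summed with weights `aᵢ aⱼ`; no finiteness is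
needed. -/
lemma ENNReal.tsum_mul_sq_le {J : Type*} (a U : J → ℝ≥0∞) (h : ∑' j, a j = 1) :
    (∑' j, a j * U j) ^ 2 ≤ ∑' j, a j * U j ^ 2 := by
  have h2 : 2 * (∑' j, a j * U j) ^ 2 ≤ 2 * ∑' j, a j * U j ^ 2 := by
    calc 2 * (∑' j, a j * U j) ^ 2 = ∑' i, ∑' j, a i * a j * (2 * (U i * U j)) := by
          rw [sq, ← ENNReal.tsum_mul_right, ← ENNReal.tsum_mul_left]
          refine tsum_congr fun i => ?_
          rw [← ENNReal.tsum_mul_left, ← ENNReal.tsum_mul_left]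
          exact tsum_congr fun j => by ring
      _ ≤ ∑' i, ∑' j, (a j * (a i * U i ^ 2) + a i * (a j * U j ^ 2)) := by
          refine ENNReal.tsum_le_tsum fun i => ENNReal.tsum_le_tsum fun j => ?_
          calc _ ≤ a i * a j * (U i ^ 2 + U j ^ 2) := by
                gcongr
                exact ENNReal.two_mul_mul_le_add_sq _ _
            _ = _ := by ring
      _ = _ := by
          simp only [ENNReal.tsum_add, ENNReal.tsum_mul_left, ENNReal.tsum_mul_right, h, one_mul,
            two_mul]
  exact (ENNReal.mul_le_mul_iff_right two_ne_zero ENNReal.ofNat_ne_top).1 h2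

lemma ENNReal.sum_sq_le_sq_sum {J : Type*} (s : Finset J) (a : J → ℝ≥0∞) :
    ∑ j ∈ s, a j ^ 2 ≤ (∑ j ∈ s, a j) ^ 2 := by
  classical
  induction s using Finset.induction_on with
  | empty => simp
  | insert j s hj ih =>
    rw [Finset.sum_insert hj, Finset.sum_insert hj, add_sq]
    calc a j ^ 2 + ∑ i ∈ s, a i ^ 2 ≤ a j ^ 2 + (∑ i ∈ s, a i) ^ 2 := by gcongr
      _ ≤ _ := by gcongr; exact le_self_add

end ENNRealInequalities

/-! ### From almost maximal correlation to almost invariance -/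

section AlmostInvariance

open scoped NNReal

variable {Y : Type*} [MeasurableSpace Y] {m : Measure Y}

/-- If `a` and `b` have equal `L²` norms and correlation within `W` of the maximum `I`, then `∫ (a -
b)²` is at most `2 W`. The pointwise inequality with parameter `s` turns this into an `L¹` bound for
the positive part of `a² - b²`; finiteness of `I` permits cancelling `s I`. -/
lemma lintegral_sq_sub_sq_le {a b : Y → ℝ≥0∞} (ha : Measurable a) (hb : Measurable b)
    {I W : ℝ≥0∞} (hI : I ≠ ∞) (haI : ∫⁻ y, a y ^ 2 ∂m = I) (hbI : ∫⁻ y, b y ^ 2 ∂m = I)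
    (hab : I ≤ ∫⁻ y, a y * b y ∂m + W) {s : ℝ≥0} (hs : s ≠ 0) :
    ∫⁻ y, (a y ^ 2 - b y ^ 2) ∂m ≤ 2 * (s⁻¹ : ℝ≥0) * I + s * W := by
  set D := ∫⁻ y, (a y ^ 2 - b y ^ 2) ∂m
  set J := ∫⁻ y, a y * b y ∂m
  have h1 : 2 * (D + s * J) ≤ 2 * ((s + 2 * (s⁻¹ : ℝ≥0)) * I) := by
    calc 2 * (D + s * J) = ∫⁻ y, (2 * (a y ^ 2 - b y ^ 2) + 2 * s * (a y * b y)) ∂m := by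
          rw [lintegral_add_left (by fun_prop), lintegral_const_mul _ (by fun_prop),
            lintegral_const_mul _ (by fun_prop)]
          ring
      _ ≤ ∫⁻ y, (s + 2 * (s⁻¹ : ℝ≥0)) * (a y ^ 2 + b y ^ 2) ∂m :=
          lintegral_mono fun y => ENNReal.two_mul_sq_sub_sq_add_le _ _ hs
      _ = _ := by
          rw [lintegral_const_mul _ (by fun_prop), lintegral_add_left (by fun_prop), haI, hbI]
          ring
  have h2 := (ENNReal.mul_le_mul_iff_right two_ne_zero ENNReal.ofNat_ne_top).1 h1
  have h3 : s * I + D ≤ s * I + (2 * (s⁻¹ : ℝ≥0) * I + s * W) := by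
    calc s * I + D ≤ s * (J + W) + D := by gcongr
      _ = (D + s * J) + s * W := by ring
      _ ≤ (s + 2 * (s⁻¹ : ℝ≥0)) * I + s * W := by gcongr
      _ = _ := by ring
  exact (ENNReal.add_le_add_iff_left (ENNReal.mul_ne_top ENNReal.coe_ne_top hI)).1 h3

/-- If `f` almost maximizes the correlation with `f ∘ T`, then `f²` is almost invariant. -/
lemma lintegral_sq_comp_sub_sq_le {T : Y → Y} (hT : MeasurePreserving T m m) {f u : Y → ℝ≥0∞}
    (hf : Measurable f) (hu : Measurable u) (hI : ∫⁻ y, f y ^ 2 ∂m ≠ ∞)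
    (hinner : ∫⁻ y, f y ^ 2 ∂m ≤ ∫⁻ y, f y * f (T y) ∂m + ∫⁻ y, f y * u y ∂m) {s : ℝ≥0}
    (hs : s ≠ 0) (hu' : s ^ 4 * ∫⁻ y, u y ^ 2 ∂m ≤ ∫⁻ y, f y ^ 2 ∂m) :
    ∫⁻ y, (f (T y) ^ 2 - f y ^ 2) ∂m ≤ 3 * (s⁻¹ : ℝ≥0) * ∫⁻ y, f y ^ 2 ∂m ∧
    ∫⁻ y, (f y ^ 2 - f (T y) ^ 2) ∂m ≤ 3 * (s⁻¹ : ℝ≥0) * ∫⁻ y, f y ^ 2 ∂m := by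
  set I := ∫⁻ y, f y ^ 2 ∂m with hIdef
  set W := ∫⁻ y, f y * u y ∂m
  have hTI : ∫⁻ y, f (T y) ^ 2 ∂m = I := hT.lintegral_comp (hf.pow_const 2)
  have hfT : Measurable fun y => f (T y) := hf.comp hT.measurable
  have hsc : (s : ℝ≥0∞) * (s⁻¹ : ℝ≥0) = 1 := by
    rw [← ENNReal.coe_mul, mul_inv_cancel₀ hs, ENNReal.coe_one]
  -- Integrate `2 f u ≤ s⁻² f² + s² u²`. The hypothesis with `s ^ 4` is what makes both terms
  -- equally small; with the `2 s⁻¹` of the previous lemma this gives the constant `3 s⁻¹`.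
  have hW : (s : ℝ≥0∞) * W ≤ (s⁻¹ : ℝ≥0) * I := by
    have h1 : 2 * W ≤ ((s ^ 2)⁻¹ : ℝ≥0) * I + (s ^ 2 : ℝ≥0) * ∫⁻ y, u y ^ 2 ∂m := by
      rw [← lintegral_const_mul _ (by fun_prop), ← lintegral_const_mul _ (by fun_prop),
        ← lintegral_const_mul _ (by fun_prop), ← lintegral_add_left (by fun_prop)]
      exact lintegral_mono fun y => ENNReal.two_mul_mul_le _ _ (pow_ne_zero 2 hs)
    have h2 : 2 * ((s : ℝ≥0∞) * W) ≤ 2 * ((s⁻¹ : ℝ≥0) * I) := by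
      calc 2 * ((s : ℝ≥0∞) * W) = s * (2 * W) := by ring
        _ ≤ s * (((s ^ 2)⁻¹ : ℝ≥0) * I + (s ^ 2 : ℝ≥0) * ∫⁻ y, u y ^ 2 ∂m) := by gcongr
        _ = (s * (s⁻¹ : ℝ≥0)) * ((s⁻¹ : ℝ≥0) * I) + 1 * (s ^ 3 * ∫⁻ y, u y ^ 2 ∂m) := by
            rw [← inv_pow]
            push_cast
            ring
        _ = (s⁻¹ : ℝ≥0) * I + (s⁻¹ : ℝ≥0) * (s ^ 4 * ∫⁻ y, u y ^ 2 ∂m) := by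
            congr 1
            · rw [hsc, one_mul]
            · rw [← hsc]
              ring
        _ ≤ (s⁻¹ : ℝ≥0) * I + (s⁻¹ : ℝ≥0) * I := by gcongr
        _ = _ := (two_mul _).symm
    exact (ENNReal.mul_le_mul_iff_right two_ne_zero ENNReal.ofNat_ne_top).1 h2
  have hfin : 2 * ((s⁻¹ : ℝ≥0) : ℝ≥0∞) * I + s * W ≤ 3 * (s⁻¹ : ℝ≥0) * I := by
    calc _ ≤ 2 * ((s⁻¹ : ℝ≥0) : ℝ≥0∞) * I + (s⁻¹ : ℝ≥0) * I := by gcongr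
      _ = _ := by ring
  refine ⟨(lintegral_sq_sub_sq_le hfT hf hI hTI rfl ?_ hs).trans hfin,
    (lintegral_sq_sub_sq_le hf hfT hI rfl hTI hinner hs).trans hfin⟩
  simpa only [mul_comm (f (T _))] using hinner

end AlmostInvariance

/-! ### Iterated transfer operators on functions of the vertex -/

section TransferSums

variable {X ι V : Type*} [MeasurableSpace X] {θ : X → X} {μ : Measure X} {α : ι → Set X}
  {κ : X → Equiv.Perm V}

/-- The `n`-th iterate of the transfer operator applied to `(x, g) ↦ U g`. -/
def transferSum (θ : X → X) (μ : Measure X) (α : ι → Set X) (κ : X → Equiv.Perm V) (U : V → ℝ≥0∞)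
    (n : ℕ) (p : X × V) : ℝ≥0∞ :=
  ∑' w : Fin n → ι, branchDensity θ μ α w p.1 * U ((wordPerm θ α κ w)⁻¹ p.2)

/-- The average of `U` over the images of a vertex under the inverse branches of order `n`. -/
def averageSum (θ : X → X) (μ : Measure X) (α : ι → Set X) (κ : X → Equiv.Perm V) (U : V → ℝ≥0∞)
    (n : ℕ) (g : V) : ℝ≥0∞ :=
  ∑' w : Fin n → ι, μ (cylinder θ α w) * U ((wordPerm θ α κ w)⁻¹ g)

/-- Every branch has the same distortion factor, independent of `n`, so the bound passes to sums
over words and later to sums over `n`. -/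
lemma HasDistortion.transferSum_le {C r : ℝ} (h : HasDistortion θ μ α C r) (U : V → ℝ≥0∞) :
    ∀ᵐ x ∂μ, ∀ᵐ y ∂μ, ∀ (n : ℕ) (g : V), transferSum θ μ α κ U n (x, g) ≤
      ENNReal.ofReal (Real.exp (C * symbolicDist θ α r x y)) * transferSum θ μ α κ U n (y, g) := by
  unfold HasDistortion at h
  filter_upwards [h] with x hx
  filter_upwards [hx] with y hy n g
  rw [transferSum, transferSum, ← ENNReal.tsum_mul_left]
  refine ENNReal.tsum_le_tsum fun w => ?_
  rw [← mul_assoc]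
  exact mul_le_mul_left (hy n w).1 _

variable [MeasurableSpace V] [Countable V] [DiscreteMeasurableSpace V] [Countable ι]
  [IsProbabilityMeasure μ] {G : Digraph V}

lemma measurable_transferSum (U : V → ℝ≥0∞) (n : ℕ) : Measurable (transferSum θ μ α κ U n) :=
  measurable_from_prod_countable_left fun _ =>
    Measurable.tsum fun w => (measurable_branchDensity (θ := θ) (μ := μ) (α := α) w).mul_const
      (U ((wordPerm θ α κ w)⁻¹ _))

/-- The average is a convex combination, with weights the measures of the cylinders, of permuted
copies of `U`, which all have the same `ℓ²` norm. -/
lemma tsum_averageSum_sq_le (h : IsMarkovMap θ μ α) (hθ : Measurable θ) (U : V → ℝ≥0∞) (n : ℕ) :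
    ∑' g, averageSum θ μ α κ U n g ^ 2 ≤ ∑' g, U g ^ 2 := by
  calc ∑' g, averageSum θ μ α κ U n g ^ 2
      ≤ ∑' g, ∑' w : Fin n → ι, μ (cylinder θ α w) * U ((wordPerm θ α κ w)⁻¹ g) ^ 2 :=
        ENNReal.tsum_le_tsum fun g => ENNReal.tsum_mul_sq_le _ _ (h.tsum_measure_cylinder hθ n)
    _ = ∑' w : Fin n → ι, μ (cylinder θ α w) * ∑' g, U ((wordPerm θ α κ w)⁻¹ g) ^ 2 := by
        rw [ENNReal.tsum_comm]
        simp only [ENNReal.tsum_mul_left]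
    _ = ∑' w : Fin n → ι, μ (cylinder θ α w) * ∑' g, U g ^ 2 :=
        tsum_congr fun w => by rw [(wordPerm θ α κ w)⁻¹.tsum_eq fun g => U g ^ 2]
    _ = _ := by rw [ENNReal.tsum_mul_right, h.tsum_measure_cylinder hθ n, one_mul]

lemma lintegral_transferSum_mul (h : IsMarkovMap θ μ α) (hinv : MeasurePreserving θ μ μ)
    (hκ : IsNearestNeighbourCocycle G α κ) (U : V → ℝ≥0∞) (n : ℕ) {k : X × V → ℝ≥0∞}
    (hk : Measurable k) :
    ∫⁻ p, transferSum θ μ α κ U n p * k p ∂(μ.prod Measure.count) =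
      ∫⁻ p, U p.2 * k ((extensionMap θ κ)^[n] p) ∂(μ.prod Measure.count) := by
  have hT := (hκ.measurable_extensionMap h hinv.measurable).iterate n
  have hcyl := fun w : Fin n → ι => h.measurableSet_cylinder hinv.measurable w
  have hk1 : ∀ g, Measurable fun x => k (x, g) := fun g => hk.comp measurable_prodMk_right
  have hU : Measurable fun p : X × V => U p.2 := (Measurable.of_discrete (f := U)).comp measurable_snd
  rw [lintegral_prod_count (f := fun p => transferSum θ μ α κ U n p * k p)
      ((measurable_transferSum U n).mul hk),
    lintegral_prod_count (f := fun p => U p.2 * k ((extensionMap θ κ)^[n] p))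
      (hU.mul (hk.comp hT))]
  calc ∑' g, ∫⁻ x, transferSum θ μ α κ U n (x, g) * k (x, g) ∂μ
      = ∑' g, ∑' w : Fin n → ι, U ((wordPerm θ α κ w)⁻¹ g) *
          ∫⁻ x in cylinder θ α w, k (θ^[n] x, g) ∂μ := by
        refine tsum_congr fun g => ?_
        simp only [transferSum, ← ENNReal.tsum_mul_right]
        rw [lintegral_tsum (f := fun (w : Fin n → ι) x => branchDensity θ μ α w x *
          U ((wordPerm θ α κ w)⁻¹ g) * k (x, g)) fun w =>
            (((measurable_branchDensity w).mul_const _).mul (hk1 g)).aemeasurable]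
        refine tsum_congr fun w => ?_
        rw [← lintegral_branchDensity_mul hinv w (hk1 g), ← lintegral_const_mul
          (f := fun x => branchDensity θ μ α w x * k (x, g)) _
          ((measurable_branchDensity w).mul (hk1 g))]
        exact lintegral_congr fun x => by ring
    _ = ∑' w : Fin n → ι, ∑' g, U g *
          ∫⁻ x in cylinder θ α w, k (θ^[n] x, wordPerm θ α κ w g) ∂μ := by
        rw [ENNReal.tsum_comm]
        refine tsum_congr fun w => ?_
        rw [← (wordPerm θ α κ w).tsum_eq]
        simp only [Equiv.Perm.inv_def, Equiv.symm_apply_apply]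
    _ = ∑' g, U g * ∑' w : Fin n → ι,
          ∫⁻ x in cylinder θ α w, k ((extensionMap θ κ)^[n] (x, g)) ∂μ := by
        rw [ENNReal.tsum_comm]
        refine tsum_congr fun g => ?_
        rw [ENNReal.tsum_mul_left]
        congr 1
        refine tsum_congr fun w => setLIntegral_congr_fun (hcyl w) fun x hx => ?_
        simp only [iterate_extensionMap, hκ.iterPerm_eq_wordPerm hx]
    _ = _ := by
        refine tsum_congr fun g => ?_
        rw [← lintegral_iUnion hcyl (h.pairwise_disjoint_cylinder n), h.iUnion_cylinder,
          setLIntegral_univ, ← lintegral_const_mul (f := fun x => k ((extensionMap θ κ)^[n] (x, g)))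
            _ ((hk.comp hT).comp measurable_prodMk_right)]

lemma HasBoundedDensities.transferSum_le {K : ℝ≥0∞} (hb : HasBoundedDensities θ μ α K)
    (U : V → ℝ≥0∞) (n : ℕ) : ∀ᵐ p ∂(μ.prod Measure.count),
      transferSum θ μ α κ U n p ≤ K * averageSum θ μ α κ U n p.2 ∧
      averageSum θ μ α κ U n p.2 ≤ K * transferSum θ μ α κ U n p := by
  filter_upwards [Measure.quasiMeasurePreserving_fst.ae hb] with p hp
  simp only [transferSum, averageSum, ← ENNReal.tsum_mul_left, ← mul_assoc]
  exact ⟨ENNReal.tsum_le_tsum fun w => mul_le_mul_left (hp n w).1 _,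
    ENNReal.tsum_le_tsum fun w => mul_le_mul_left (hp n w).2 _⟩

lemma lintegral_snd_prod_count (u : V → ℝ≥0∞) :
    ∫⁻ p, u p.2 ∂(μ.prod Measure.count) = ∑' g, u g := by
  rw [lintegral_prod_count (f := fun p => u p.2)
    ((Measurable.of_discrete (f := u)).comp measurable_snd)]
  simp

lemma lintegral_transferSum_sq_ne_top (h : IsMarkovMap θ μ α) (hθ : Measurable θ) {K : ℝ≥0∞}
    (hK : K ≠ ∞) (hb : HasBoundedDensities θ μ α K) {U : V → ℝ≥0∞} (hU : ∑' g, U g ^ 2 ≠ ∞)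
    (n : ℕ) : ∫⁻ p, transferSum θ μ α κ U n p ^ 2 ∂(μ.prod Measure.count) ≠ ∞ := by
  refine ne_top_of_le_ne_top (ENNReal.mul_ne_top (ENNReal.pow_ne_top hK (n := 2)) hU) ?_
  calc ∫⁻ p, transferSum θ μ α κ U n p ^ 2 ∂(μ.prod Measure.count)
      ≤ ∫⁻ p, K ^ 2 * averageSum θ μ α κ U n p.2 ^ 2 ∂(μ.prod Measure.count) := by
        refine lintegral_mono_ae ?_
        filter_upwards [hb.transferSum_le U n] with p hp
        rw [← mul_pow]
        gcongr
        exact hp.1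
    _ = K ^ 2 * ∑' g, averageSum θ μ α κ U n g ^ 2 := by
        rw [lintegral_snd_prod_count fun g => K ^ 2 * averageSum θ μ α κ U n g ^ 2,
          ENNReal.tsum_mul_left]
    _ ≤ _ := by
        exact mul_le_mul_right (tsum_averageSum_sq_le h hθ U n) _

lemma tsum_averageSum_sq_le_lintegral {K : ℝ≥0∞} (hb : HasBoundedDensities θ μ α K)
    (U : V → ℝ≥0∞) (n : ℕ) : ∑' g, averageSum θ μ α κ U n g ^ 2 ≤
      K ^ 2 * ∫⁻ p, transferSum θ μ α κ U n p ^ 2 ∂(μ.prod Measure.count) := by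
  rw [← lintegral_snd_prod_count (μ := μ) fun g => averageSum θ μ α κ U n g ^ 2,
    ← lintegral_const_mul _ ((measurable_transferSum U n).pow_const 2)]
  refine lintegral_mono_ae ?_
  filter_upwards [hb.transferSum_le U n] with p hp
  rw [← mul_pow]
  gcongr
  exact hp.2

/-- With `uₙ` the `n`-th image of `U`, duality gives `⟨uₙ₊₁, uₙ₊₁⟩ = ⟨uₙ, uₙ₊₁ ∘ T⟩`. As `T`
preserves the measure, twice this is at most `‖uₙ‖² + ‖uₙ₊₁‖²`, and one finite term cancels. -/
lemma lintegral_transferSum_sq_antitone (h : IsMarkovMap θ μ α) (hinv : MeasurePreserving θ μ μ)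
    (hκ : IsNearestNeighbourCocycle G α κ) {K : ℝ≥0∞} (hK : K ≠ ∞)
    (hb : HasBoundedDensities θ μ α K) {U : V → ℝ≥0∞} (hU : ∑' g, U g ^ 2 ≠ ∞) :
    Antitone fun n => ∫⁻ p, transferSum θ μ α κ U n p ^ 2 ∂(μ.prod Measure.count) := by
  refine antitone_nat_of_succ_le fun n => ?_
  have hT := hκ.measurePreserving_extensionMap h hinv
  have hm := measurable_transferSum (θ := θ) (μ := μ) (α := α) (κ := κ) U
  have hfin := lintegral_transferSum_sq_ne_top (κ := κ) h hinv.measurable hK hb hU (n + 1)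
  set I := ∫⁻ p, transferSum θ μ α κ U (n + 1) p ^ 2 ∂(μ.prod Measure.count)
  have h1 : I = ∫⁻ p, transferSum θ μ α κ U n p *
      transferSum θ μ α κ U (n + 1) (extensionMap θ κ p) ∂(μ.prod Measure.count) := by
    simp only [I, sq]
    rw [lintegral_transferSum_mul h hinv hκ U (n + 1) (hm _),
      lintegral_transferSum_mul h hinv hκ U n (k := fun p => transferSum θ μ α κ U (n + 1)
        (extensionMap θ κ p)) ((hm _).comp hT.measurable)]
    simp only [Function.iterate_succ_apply']
  have h2 : I + I ≤ ∫⁻ p, transferSum θ μ α κ U n p ^ 2 ∂(μ.prod Measure.count) + I := by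
    have h3 : ∫⁻ p, transferSum θ μ α κ U (n + 1) (extensionMap θ κ p) ^ 2
        ∂(μ.prod Measure.count) = I := hT.lintegral_comp ((hm _).pow_const 2)
    nth_rewrite 3 [← h3]
    have hmT : Measurable fun p => transferSum θ μ α κ U n p *
        transferSum θ μ α κ U (n + 1) (extensionMap θ κ p) :=
      (hm _).mul ((hm _).comp hT.measurable)
    rw [← two_mul, h1, ← lintegral_const_mul _ hmT, ← lintegral_add_left ((hm _).pow_const 2)]
    exact lintegral_mono fun p => ENNReal.two_mul_mul_le_add_sq _ _
  exact (ENNReal.add_le_add_iff_right hfin).1 h2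

end TransferSums

/-! ### Sums of iterates and almost invariant densities -/

section CesaroSums

open scoped NNReal

variable {X ι V : Type*} [MeasurableSpace X] {θ : X → X} {μ : Measure X} {α : ι → Set X}
  {κ : X → Equiv.Perm V}

/-- The sum of the first `N` iterates of the transfer operator applied to `(x, g) ↦ U g`. -/
def cesaroSum (θ : X → X) (μ : Measure X) (α : ι → Set X) (κ : X → Equiv.Perm V) (U : V → ℝ≥0∞)
    (N : ℕ) (p : X × V) : ℝ≥0∞ :=
  ∑ n ∈ Finset.range N, transferSum θ μ α κ U n p

lemma HasDistortion.cesaroSum_le {C r : ℝ} (h : HasDistortion θ μ α C r) (U : V → ℝ≥0∞) :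
    ∀ᵐ x ∂μ, ∀ᵐ y ∂μ, ∀ (N : ℕ) (g : V), cesaroSum θ μ α κ U N (x, g) ≤
      ENNReal.ofReal (Real.exp (C * symbolicDist θ α r x y)) * cesaroSum θ μ α κ U N (y, g) := by
  filter_upwards [h.transferSum_le (κ := κ) U] with x hx
  filter_upwards [hx] with y hy N g
  rw [cesaroSum, cesaroSum, Finset.mul_sum]
  exact Finset.sum_le_sum fun n _ => hy n g

variable [MeasurableSpace V] [Countable V] [DiscreteMeasurableSpace V] [Countable ι]
  [IsProbabilityMeasure μ] {G : Digraph V}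

lemma measurable_cesaroSum (U : V → ℝ≥0∞) (N : ℕ) : Measurable (cesaroSum θ μ α κ U N) :=
  Finset.measurable_sum _ fun n _ => measurable_transferSum U n

lemma lintegral_cesaroSum_mul (U : V → ℝ≥0∞) (N : ℕ) {k : X × V → ℝ≥0∞} (hk : Measurable k) :
    ∫⁻ p, cesaroSum θ μ α κ U N p * k p ∂(μ.prod Measure.count) =
      ∑ n ∈ Finset.range N, ∫⁻ p, transferSum θ μ α κ U n p * k p ∂(μ.prod Measure.count) := by
  simp only [cesaroSum, Finset.sum_mul]
  exact lintegral_finsetSum _ fun n _ => (measurable_transferSum U n).mul hk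

/-- By duality the correlation of `f` with `f ∘ T` is the sum of the pairings of `f` with the images
of `U` of orders `1` to `N`. The term of order `0` is the pairing with `U`; adding it covers all
terms of `⟨f, f⟩`. -/
lemma lintegral_cesaroSum_sq_le_correlation (h : IsMarkovMap θ μ α)
    (hinv : MeasurePreserving θ μ μ) (hκ : IsNearestNeighbourCocycle G α κ) (U : V → ℝ≥0∞)
    (N : ℕ) :
    ∫⁻ p, cesaroSum θ μ α κ U N p ^ 2 ∂(μ.prod Measure.count) ≤
      ∫⁻ p, cesaroSum θ μ α κ U N p * cesaroSum θ μ α κ U N (extensionMap θ κ p)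
        ∂(μ.prod Measure.count) +
      ∫⁻ p, cesaroSum θ μ α κ U N p * U p.2 ∂(μ.prod Measure.count) := by
  have hT := hκ.measurable_extensionMap h hinv.measurable
  set f := cesaroSum θ μ α κ U N with hf
  have hfm : Measurable f := measurable_cesaroSum U N
  have h1 : ∫⁻ p, f p * f (extensionMap θ κ p) ∂(μ.prod Measure.count) =
      ∑ n ∈ Finset.range N, ∫⁻ p, transferSum θ μ α κ U (n + 1) p * f p ∂(μ.prod Measure.count) := by
    rw [hf, lintegral_cesaroSum_mul U N (k := fun p => f (extensionMap θ κ p)) (hfm.comp hT), ← hf]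
    refine Finset.sum_congr rfl fun n _ => ?_
    rw [lintegral_transferSum_mul h hinv hκ U n (k := fun p => f (extensionMap θ κ p))
      (hfm.comp hT), lintegral_transferSum_mul h hinv hκ U (n + 1) hfm]
    simp only [Function.iterate_succ_apply']
  have h2 : ∫⁻ p, f p * U p.2 ∂(μ.prod Measure.count) =
      ∫⁻ p, transferSum θ μ α κ U 0 p * f p ∂(μ.prod Measure.count) := by
    rw [lintegral_transferSum_mul h hinv hκ U 0 hfm]
    exact lintegral_congr fun p => mul_comm _ _
  rw [h1, h2, ← Finset.sum_range_succ' fun n =>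
    ∫⁻ p, transferSum θ μ α κ U n p * f p ∂(μ.prod Measure.count)]
  simp only [sq]
  rw [hf, lintegral_cesaroSum_mul U N hfm]
  exact Finset.sum_le_sum_of_subset (Finset.range_mono N.le_succ)

lemma lintegral_cesaroSum_sq_ne_top (h : IsMarkovMap θ μ α) (hθ : Measurable θ) {K : ℝ≥0∞}
    (hK : K ≠ ∞) (hb : HasBoundedDensities θ μ α K) {U : V → ℝ≥0∞} (hU : ∑' g, U g ^ 2 ≠ ∞)
    (N : ℕ) : ∫⁻ p, cesaroSum θ μ α κ U N p ^ 2 ∂(μ.prod Measure.count) ≠ ∞ := by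
  induction N with
  | zero => simp [cesaroSum]
  | succ N ih =>
    have h1 := lintegral_transferSum_sq_ne_top (κ := κ) h hθ hK hb hU N
    refine ne_top_of_le_ne_top (ENNReal.mul_ne_top ENNReal.ofNat_ne_top (b := _)
      (ENNReal.add_ne_top.2 ⟨ih, h1⟩) (a := 2)) ?_
    rw [← lintegral_add_left ((measurable_cesaroSum U N).pow_const 2),
      ← lintegral_const_mul (f := fun p => cesaroSum θ μ α κ U N p ^ 2 +
        transferSum θ μ α κ U N p ^ 2) _ (((measurable_cesaroSum U N).pow_const 2).add
        ((measurable_transferSum U N).pow_const 2))]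
    refine lintegral_mono fun p => ?_
    simp only [cesaroSum, Finset.sum_range_succ]
    set a := ∑ n ∈ Finset.range N, transferSum θ μ α κ U n p
    set b := transferSum θ μ α κ U N p
    calc (a + b) ^ 2 = a ^ 2 + b ^ 2 + 2 * (a * b) := by ring
      _ ≤ a ^ 2 + b ^ 2 + (a ^ 2 + b ^ 2) := by
        gcongr
        exact ENNReal.two_mul_mul_le_add_sq a b
      _ = _ := (two_mul _).symm

/-- The summands are nonnegative, so the square of the sum dominates the sum of squares, and by
monotonicity each of these `N` integrals is at least the one of order `N + 1`. -/
lemma le_lintegral_cesaroSum_sq (h : IsMarkovMap θ μ α) (hinv : MeasurePreserving θ μ μ)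
    (hκ : IsNearestNeighbourCocycle G α κ) {K : ℝ≥0∞} (hK : K ≠ ∞)
    (hb : HasBoundedDensities θ μ α K) {U : V → ℝ≥0∞} (hU : ∑' g, U g ^ 2 ≠ ∞) (N : ℕ) :
    N * ∫⁻ p, transferSum θ μ α κ U (N + 1) p ^ 2 ∂(μ.prod Measure.count) ≤
      ∫⁻ p, cesaroSum θ μ α κ U N p ^ 2 ∂(μ.prod Measure.count) := by
  calc N * ∫⁻ p, transferSum θ μ α κ U (N + 1) p ^ 2 ∂(μ.prod Measure.count)
      = ∑ n ∈ Finset.range N, ∫⁻ p, transferSum θ μ α κ U (N + 1) p ^ 2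
          ∂(μ.prod Measure.count) := by simp
    _ ≤ ∑ n ∈ Finset.range N, ∫⁻ p, transferSum θ μ α κ U n p ^ 2 ∂(μ.prod Measure.count) :=
        Finset.sum_le_sum fun n hn => lintegral_transferSum_sq_antitone h hinv hκ hK hb hU
          ((Finset.mem_range.1 hn).le.trans N.le_succ)
    _ = ∫⁻ p, ∑ n ∈ Finset.range N, transferSum θ μ α κ U n p ^ 2 ∂(μ.prod Measure.count) :=
        (lintegral_finsetSum _ fun n _ => (measurable_transferSum U n).pow_const 2).symm
    _ ≤ _ := lintegral_mono fun p => ENNReal.sum_sq_le_sq_sum _ _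

/-- If the averages do not contract `ℓ²` exponentially, there are almost invariant densities. -/
lemma exists_almost_invariant_density (h : IsMarkovMap θ μ α) (hinv : MeasurePreserving θ μ μ)
    (hκ : IsNearestNeighbourCocycle G α κ) {K : ℝ≥0∞} (hK : K ≠ ∞)
    (hb : HasBoundedDensities θ μ α K) {C r : ℝ} (hd : HasDistortion θ μ α C r) {M : ℝ≥0∞}
    (hM : M ≠ ∞)
    (H : ∀ N, ∃ U : V → ℝ≥0∞, ∑' g, U g ^ 2 ≠ 0 ∧ ∑' g, U g ^ 2 ≠ ∞ ∧
      ∑' g, U g ^ 2 ≤ M * ∑' g, averageSum θ μ α κ U (N + 1) g ^ 2) {s : ℝ≥0} (hs : s ≠ 0) :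
    ∃ q : X × V → ℝ≥0∞, Measurable q ∧ ∫⁻ p, q p ∂(μ.prod Measure.count) ≠ 0 ∧
      ∫⁻ p, q p ∂(μ.prod Measure.count) ≠ ∞ ∧
      ∫⁻ p, (q (extensionMap θ κ p) - q p) ∂(μ.prod Measure.count) ≤
        3 * (s⁻¹ : ℝ≥0) * ∫⁻ p, q p ∂(μ.prod Measure.count) ∧
      ∫⁻ p, (q p - q (extensionMap θ κ p)) ∂(μ.prod Measure.count) ≤
        3 * (s⁻¹ : ℝ≥0) * ∫⁻ p, q p ∂(μ.prod Measure.count) ∧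
      ∀ᵐ x ∂μ, ∀ᵐ y ∂μ, ∀ g, q (x, g) ≤
        ENNReal.ofReal (Real.exp (2 * C * symbolicDist θ α r x y)) * q (y, g) := by
  have hfin : (s : ℝ≥0∞) ^ 4 * M * K ^ 2 ≠ ∞ :=
    ENNReal.mul_ne_top (ENNReal.mul_ne_top (by simp) hM) (ENNReal.pow_ne_top hK)
  -- The squared norm of the sum is at least `N / (M K²)` times that of `U`; this `N` makes the
  -- ratio at least `s⁴`.
  obtain ⟨N, hN⟩ := ENNReal.exists_nat_gt hfin
  obtain ⟨U, hU0, hU, hUM⟩ := H N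
  have hbig : s ^ 4 * ∑' g, U g ^ 2 ≤
      ∫⁻ p, cesaroSum θ μ α κ U N p ^ 2 ∂(μ.prod Measure.count) := by
    refine le_trans ?_ (le_lintegral_cesaroSum_sq h hinv hκ hK hb hU N)
    calc s ^ 4 * ∑' g, U g ^ 2
        ≤ s ^ 4 * (M * (K ^ 2 * ∫⁻ p, transferSum θ μ α κ U (N + 1) p ^ 2
            ∂(μ.prod Measure.count))) := by
          gcongr
          refine hUM.trans (mul_le_mul_right ?_ _)
          exact tsum_averageSum_sq_le_lintegral hb U (N + 1)
      _ = s ^ 4 * M * K ^ 2 * ∫⁻ p, transferSum θ μ α κ U (N + 1) p ^ 2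
            ∂(μ.prod Measure.count) := by ring
      _ ≤ _ := by gcongr
  have hI := lintegral_cesaroSum_sq_ne_top (κ := κ) h hinv.measurable hK hb hU N
  obtain ⟨h1, h2⟩ := lintegral_sq_comp_sub_sq_le (hκ.measurePreserving_extensionMap h hinv)
    (measurable_cesaroSum U N) (u := fun p => U p.2)
    ((Measurable.of_discrete (f := U)).comp measurable_snd) hI
    (lintegral_cesaroSum_sq_le_correlation h hinv hκ U N) hs
    (by rwa [lintegral_snd_prod_count fun g => U g ^ 2])
  -- Squaring doubles the distortion constant, whence `2 * C`.
  refine ⟨fun p => cesaroSum θ μ α κ U N p ^ 2, (measurable_cesaroSum U N).pow_const 2, ?_, hI,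
    h1, h2, ?_⟩
  · refine fun h0 => (mul_ne_zero ?_ hU0) (le_zero_iff.1 (hbig.trans_eq h0))
    exact pow_ne_zero _ (by exact_mod_cast hs)
  · filter_upwards [hd.cesaroSum_le (κ := κ) U] with x hx
    filter_upwards [hx] with y hy g
    have h3 := pow_le_pow_left' (hy N g) 2
    rwa [mul_pow, ← ENNReal.ofReal_pow (Real.exp_pos _).le, ← Real.exp_nat_mul, Nat.cast_ofNat,
      ← mul_assoc] at h3

end CesaroSums

/-! ### Layer cake formula and the choice of a level -/

section LayerCake

variable {Y : Type*} [MeasurableSpace Y] {m : Measure Y} [SFinite m]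

lemma lintegral_measure_superlevel {a : Y → ℝ} (ha : Measurable a) :
    ∫⁻ t in Set.Ioi 0, m {y | t < a y} = ∫⁻ y, ENNReal.ofReal (a y) ∂m := by
  have hS : MeasurableSet {z : Y × ℝ | z.2 < a z.1} :=
    measurableSet_lt measurable_snd (ha.comp measurable_fst)
  have h1 := (Measure.prod_apply (μ := m) (ν := volume.restrict (Set.Ioi (0 : ℝ))) hS).symm.trans
    (Measure.prod_apply_symm hS)
  refine h1.symm.trans (lintegral_congr fun y => ?_)
  rw [Measure.restrict_apply (measurable_prodMk_left hS),
    show Prod.mk y ⁻¹' {z : Y × ℝ | z.2 < a z.1} ∩ Set.Ioi 0 = Set.Ioo 0 (a y) by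
      ext t; simp [and_comm], Real.volume_Ioo, sub_zero]

/-- For fixed `y`, the levels `t` with `b y ≤ t < a y` form an interval whose length is the positive
part of `a y - b y`; then exchange the integrals. -/
lemma lintegral_measure_crossing_le {a b : Y → ℝ} (ha : Measurable a) (hb : Measurable b) :
    ∫⁻ t in Set.Ioi 0, m {y | t < a y ∧ b y ≤ t} ≤ ∫⁻ y, ENNReal.ofReal (a y - b y) ∂m := by
  have hS : MeasurableSet {z : Y × ℝ | z.2 < a z.1 ∧ b z.1 ≤ z.2} :=
    (measurableSet_lt measurable_snd (ha.comp measurable_fst)).inter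
      (measurableSet_le (hb.comp measurable_fst) measurable_snd)
  have h1 := (Measure.prod_apply (μ := m) (ν := volume.restrict (Set.Ioi (0 : ℝ))) hS).symm.trans
    (Measure.prod_apply_symm hS)
  refine h1.symm.trans_le (lintegral_mono fun y => ?_)
  refine (Measure.restrict_apply_le _ _).trans ?_
  rw [← Real.volume_Ico]
  exact measure_mono fun t ht => ⟨ht.2, ht.1⟩

lemma exists_measure_crossing_lt {a b : Y → ℝ} (ha : Measurable a) (hb : Measurable b) {ε : ℝ≥0∞}
    (h : ∫⁻ y, ENNReal.ofReal (a y - b y) ∂m < ε * ∫⁻ y, ENNReal.ofReal (a y) ∂m) :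
    ∃ t : ℝ, 0 < t ∧ m {y | t < a y ∧ b y ≤ t} < ε * m {y | t < a y} := by
  by_contra! H
  refine absurd h (not_lt.2 ?_)
  rw [← lintegral_measure_superlevel ha]
  refine le_trans ?_ (lintegral_measure_crossing_le ha hb)
  have hanti : Antitone fun t => m {y | t < a y} := fun t t' htt' =>
    measure_mono fun y hy => lt_of_le_of_lt htt' hy
  rw [← lintegral_const_mul _ hanti.measurable]
  exact setLIntegral_mono' measurableSet_Ioi fun t ht => H t ht

end LayerCake

/-! ### Oscillation on the fibers and the construction of Følner sets -/

section Oscillation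

open scoped NNReal

variable {X ι V : Type*} [MeasurableSpace X] {θ : X → X} {μ : Measure X} {α : ι → Set X}
  {κ : X → Equiv.Perm V}

/-- The mean oscillation of `q` on the fiber over `g`. -/
def fiberOscillation (μ : Measure X) (q : X × V → ℝ≥0∞) (g : V) : ℝ≥0∞ :=
  ∫⁻ x, ∫⁻ y, (q (x, g) - q (y, g)) ∂μ ∂μ

/-- The mean of `q` on the fiber over `g`. -/
def fiberMean (μ : Measure X) (q : X × V → ℝ≥0∞) (g : V) : ℝ≥0∞ :=
  ∫⁻ x, q (x, g) ∂μ

/-- Telescoping along the orbit. Truncated subtraction sees only one sign, so both directions are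
carried. -/
lemma lintegral_iterate_sub_le {Y : Type*} [MeasurableSpace Y] {m : Measure Y} {T : Y → Y}
    (hT : MeasurePreserving T m m) {q : Y → ℝ≥0∞} (hq : Measurable q) {c : ℝ≥0∞}
    (h1 : ∫⁻ y, (q (T y) - q y) ∂m ≤ c) (h2 : ∫⁻ y, (q y - q (T y)) ∂m ≤ c) (k : ℕ) :
    ∫⁻ y, (q (T^[k] y) - q y) ∂m ≤ k * c ∧ ∫⁻ y, (q y - q (T^[k] y)) ∂m ≤ k * c := by
  induction k with
  | zero => simp
  | succ k ih =>
    have hk := hq.comp (hT.measurable.iterate k)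
    have hqT := hq.comp hT.measurable
    have e1 : ∫⁻ y, (q (T^[k] (T y)) - q (T y)) ∂m = ∫⁻ y, (q (T^[k] y) - q y) ∂m :=
      hT.lintegral_comp (f := fun y => q (T^[k] y) - q y) (hk.sub hq)
    have e2 : ∫⁻ y, (q (T y) - q (T^[k] (T y))) ∂m = ∫⁻ y, (q y - q (T^[k] y)) ∂m :=
      hT.lintegral_comp (f := fun y => q y - q (T^[k] y)) (hq.sub hk)
    simp only [Function.iterate_succ_apply]
    push_cast
    rw [add_mul, one_mul]
    constructor
    · refine le_trans ?_ (add_le_add (e1.trans_le ih.1) h1)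
      rw [← lintegral_add_right (g := fun y => q (T y) - q y) _ (hqT.sub hq)]
      exact lintegral_mono fun y => tsub_le_tsub_add_tsub
    · refine le_trans ?_ (add_le_add (e2.trans_le ih.2) h2)
      rw [← lintegral_add_right (g := fun y => q y - q (T y)) _ (hq.sub hqT)]
      exact lintegral_mono fun y => tsub_le_tsub_add_tsub.trans_eq (add_comm _ _)

variable [IsProbabilityMeasure μ]

lemma HasBoundedDensities.measure_cylinder_mul_lintegral_le {K : ℝ≥0∞}
    (hb : HasBoundedDensities θ μ α K) (hinv : MeasurePreserving θ μ μ) {n : ℕ} (w : Fin n → ι)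
    {f : X → ℝ≥0∞} (hf : Measurable f) :
    μ (cylinder θ α w) * ∫⁻ x, f x ∂μ ≤ K * ∫⁻ x in cylinder θ α w, f (θ^[n] x) ∂μ := by
  rw [← lintegral_branchDensity_mul hinv w hf, ← lintegral_const_mul _ hf,
    ← lintegral_const_mul (f := fun x => branchDensity θ μ α w x * f x) _
      ((measurable_branchDensity w).mul hf)]
  refine lintegral_mono_ae ?_
  filter_upwards [hb] with x hx
  rw [← mul_assoc]
  exact mul_le_mul_left (hx n w).2 _

variable [MeasurableSpace V] [Countable V] [DiscreteMeasurableSpace V] [Countable ι]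
  {G : Digraph V}

lemma measurable_section {q : X × V → ℝ≥0∞} (hq : Measurable q) (g : V) :
    Measurable fun x => q (x, g) :=
  hq.comp measurable_prodMk_right

/-- Bounded distortion, used once in each variable, pulls the oscillation over the image fiber back
to that of `a = q ∘ Tⁿ` over `[w] × {g}`. There `a x - a y` splits into `a - q` at `x`, `q x - q y`,
and `q - a` at `y`. The outer terms are defects of invariance, the middle one is small because `x`
and `y` share the word `w`. -/
lemma fiberOscillation_wordPerm_le (h : IsMarkovMap θ μ α) (hinv : MeasurePreserving θ μ μ)
    (hκ : IsNearestNeighbourCocycle G α κ) {K : ℝ≥0∞} (hb : HasBoundedDensities θ μ α K)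
    {q : X × V → ℝ≥0∞} (hq : Measurable q) {n : ℕ} (w : Fin n → ι) {K₂ δ : ℝ≥0∞}
    (hK₂ : ∀ᵐ x ∂μ, ∀ᵐ y ∂μ, ∀ g, q (x, g) ≤ K₂ * q (y, g))
    (hδ : ∀ᵐ x ∂μ, ∀ᵐ y ∂μ, ∀ g, x ∈ cylinder θ α w → y ∈ cylinder θ α w →
      q (x, g) ≤ (1 + δ) * q (y, g)) (g : V) :
    μ (cylinder θ α w) ^ 2 * fiberOscillation μ q (wordPerm θ α κ w g) ≤
      K ^ 2 * (μ (cylinder θ α w) * ∫⁻ x, (q ((extensionMap θ κ)^[n] (x, g)) - q (x, g)) ∂μ +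
        μ (cylinder θ α w) * ∫⁻ x, (q (x, g) - q ((extensionMap θ κ)^[n] (x, g))) ∂μ +
        μ (cylinder θ α w) ^ 2 * (δ * K₂ * fiberMean μ q g)) := by
  have hcyl := h.measurableSet_cylinder hinv.measurable w
  have hTn := (hκ.measurable_extensionMap h hinv.measurable).iterate n
  set W := cylinder θ α w
  set g' := wordPerm θ α κ w g
  have hqg := measurable_section hq g
  have hqg' := measurable_section hq g'
  set a : X → ℝ≥0∞ := fun x => q ((extensionMap θ κ)^[n] (x, g)) with ha
  have ham : Measurable a := measurable_section (hq.comp hTn) g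
  have haW : ∀ x ∈ W, a x = q (θ^[n] x, g') := fun x hx => by
    simp only [ha, iterate_extensionMap, hκ.iterPerm_eq_wordPerm hx, g']
  have step1 : μ W ^ 2 * fiberOscillation μ q g' ≤
      K ^ 2 * ∫⁻ x in W, ∫⁻ y in W, (a x - a y) ∂μ ∂μ := by
    have hin : Measurable fun x => ∫⁻ y, (q (x, g') - q (y, g')) ∂μ :=
      Measurable.lintegral_prod_right' (f := fun z : X × X => q (z.1, g') - q (z.2, g'))
        ((hqg'.comp measurable_fst).sub (hqg'.comp measurable_snd))
    calc μ W ^ 2 * fiberOscillation μ q g'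
        = μ W * (μ W * ∫⁻ x, ∫⁻ y, (q (x, g') - q (y, g')) ∂μ ∂μ) := by
          rw [sq, mul_assoc]; rfl
      _ ≤ μ W * (K * ∫⁻ x in W, ∫⁻ y, (q (θ^[n] x, g') - q (y, g')) ∂μ ∂μ) :=
          mul_le_mul_right (hb.measure_cylinder_mul_lintegral_le hinv w hin) _
      _ = K * ∫⁻ x in W, μ W * ∫⁻ y, (q (θ^[n] x, g') - q (y, g')) ∂μ ∂μ := by
          rw [lintegral_const_mul (f := fun x => ∫⁻ y, (q (θ^[n] x, g') - q (y, g')) ∂μ) _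
            (hin.comp (hinv.measurable.iterate n)), mul_left_comm]
      _ ≤ K * ∫⁻ x in W, K * ∫⁻ y in W, (q (θ^[n] x, g') - q (θ^[n] y, g')) ∂μ ∂μ :=
          mul_le_mul_right (lintegral_mono fun x => hb.measure_cylinder_mul_lintegral_le hinv w
            (f := fun y => q (θ^[n] x, g') - q (y, g')) (measurable_const.sub hqg')) _
      _ = K * ∫⁻ x in W, K * ∫⁻ y in W, (a x - a y) ∂μ ∂μ := by
          congr 1
          refine setLIntegral_congr_fun hcyl fun x hx => ?_
          congr 1
          refine setLIntegral_congr_fun hcyl fun y hy => ?_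
          simp only [haW x hx, haW y hy]
      _ = _ := by
          rw [lintegral_const_mul, sq, mul_assoc]
          exact Measurable.lintegral_prod_right' (f := fun z : X × X => a z.1 - a z.2)
            ((ham.comp measurable_fst).sub (ham.comp measurable_snd))
  refine step1.trans (mul_le_mul_right ?_ _)
  set E₁ := ∫⁻ x, (a x - q (x, g)) ∂μ
  set E₂ := ∫⁻ x, (q (x, g) - a x) ∂μ
  have hmean : ∀ᵐ y ∂μ, q (y, g) ≤ K₂ * fiberMean μ q g := by
    filter_upwards [hK₂] with y hy
    calc q (y, g) = ∫⁻ _, q (y, g) ∂μ := by simp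
      _ ≤ ∫⁻ x, K₂ * q (x, g) ∂μ := by
        refine lintegral_mono_ae ?_
        filter_upwards [hy] with x hx using hx g
      _ = _ := lintegral_const_mul _ hqg
  calc ∫⁻ x in W, ∫⁻ y in W, (a x - a y) ∂μ ∂μ
      ≤ ∫⁻ x in W, ∫⁻ y in W,
          ((a x - q (x, g)) + (δ * K₂ * fiberMean μ q g + (q (y, g) - a y))) ∂μ ∂μ := by
        refine lintegral_mono_ae ?_
        filter_upwards [ae_restrict_of_ae hδ, ae_restrict_mem hcyl] with x hx hxW
        refine lintegral_mono_ae ?_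
        filter_upwards [ae_restrict_of_ae hx, ae_restrict_mem hcyl, ae_restrict_of_ae hmean]
          with y hy hyW hyK
        refine tsub_le_tsub_add_tsub.trans (add_le_add le_rfl
          (tsub_le_tsub_add_tsub.trans (add_le_add (?_ : q (x, g) - q (y, g) ≤ _) le_rfl)))
        rw [tsub_le_iff_right]
        calc q (x, g) ≤ (1 + δ) * q (y, g) := hy g hxW hyW
          _ = δ * q (y, g) + q (y, g) := by ring
          _ ≤ _ := by
            rw [mul_assoc]
            gcongr
    _ = ∫⁻ x in W, ((a x - q (x, g)) * μ W +
          (δ * K₂ * fiberMean μ q g * μ W + ∫⁻ y in W, (q (y, g) - a y) ∂μ)) ∂μ := by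
        refine lintegral_congr fun x => ?_
        rw [lintegral_add_left measurable_const, lintegral_add_left measurable_const]
        simp
    _ = (∫⁻ x in W, (a x - q (x, g)) ∂μ) * μ W +
          (δ * K₂ * fiberMean μ q g * μ W + ∫⁻ y in W, (q (y, g) - a y) ∂μ) * μ W := by
        rw [lintegral_add_right _ measurable_const,
          lintegral_mul_const (f := fun x => a x - q (x, g)) _ (ham.sub hqg)]
        simp
    _ ≤ E₁ * μ W + (δ * K₂ * fiberMean μ q g * μ W + E₂) * μ W := by
        gcongr
        · exact setLIntegral_le_lintegral _ _
        · exact setLIntegral_le_lintegral _ _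
    _ = _ := by ring

lemma tsum_fiberMean {q : X × V → ℝ≥0∞} (hq : Measurable q) :
    ∑' g, fiberMean μ q g = ∫⁻ p, q p ∂(μ.prod Measure.count) :=
  (lintegral_prod_count hq).symm

/-- One word suffices for all fibers, since it permutes the vertices. The price is division by the
measure of its cylinder, so `η` has to be small relative to that measure. -/
lemma tsum_fiberOscillation_le (h : IsMarkovMap θ μ α) (hinv : MeasurePreserving θ μ μ)
    (hκ : IsNearestNeighbourCocycle G α κ) {K : ℝ≥0∞} (hb : HasBoundedDensities θ μ α K)
    {q : X × V → ℝ≥0∞} (hq : Measurable q) {n : ℕ} {w : Fin n → ι}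
    (hw : μ (cylinder θ α w) ≠ 0) {K₂ δ η δ' : ℝ≥0∞}
    (hK₂ : ∀ᵐ x ∂μ, ∀ᵐ y ∂μ, ∀ g, q (x, g) ≤ K₂ * q (y, g))
    (hδ : ∀ᵐ x ∂μ, ∀ᵐ y ∂μ, ∀ g, x ∈ cylinder θ α w → y ∈ cylinder θ α w →
      q (x, g) ≤ (1 + δ) * q (y, g))
    (h1 : ∫⁻ p, (q (extensionMap θ κ p) - q p) ∂(μ.prod Measure.count) ≤
      η * ∫⁻ p, q p ∂(μ.prod Measure.count))
    (h2 : ∫⁻ p, (q p - q (extensionMap θ κ p)) ∂(μ.prod Measure.count) ≤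
      η * ∫⁻ p, q p ∂(μ.prod Measure.count))
    (hη : 2 * n * η ≤ δ' * μ (cylinder θ α w)) :
    ∑' g, fiberOscillation μ q g ≤
      K ^ 2 * (δ' + δ * K₂) * ∫⁻ p, q p ∂(μ.prod Measure.count) := by
  have hT := hκ.measurePreserving_extensionMap h hinv
  have hqT := hq.comp (hT.measurable.iterate n)
  obtain ⟨e1, e2⟩ := lintegral_iterate_sub_le hT hq h1 h2 n
  set I := ∫⁻ p, q p ∂(μ.prod Measure.count) with hI
  set c := μ (cylinder θ α w)
  rw [lintegral_prod_count (f := fun p => q ((extensionMap θ κ)^[n] p) - q p) (hqT.sub hq)] at e1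
  rw [lintegral_prod_count (f := fun p => q p - q ((extensionMap θ κ)^[n] p)) (hq.sub hqT)] at e2
  have hc0 : c ^ 2 ≠ 0 := pow_ne_zero 2 hw
  have hc : c ^ 2 ≠ ∞ := ENNReal.pow_ne_top (measure_ne_top _ _)
  refine (ENNReal.mul_le_mul_iff_right hc0 hc).1 ?_
  calc c ^ 2 * ∑' g, fiberOscillation μ q g
      = ∑' g, c ^ 2 * fiberOscillation μ q (wordPerm θ α κ w g) := by
        rw [ENNReal.tsum_mul_left, (wordPerm θ α κ w).tsum_eq]
    _ ≤ ∑' g, K ^ 2 * (c * ∫⁻ x, (q ((extensionMap θ κ)^[n] (x, g)) - q (x, g)) ∂μ +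
        c * ∫⁻ x, (q (x, g) - q ((extensionMap θ κ)^[n] (x, g))) ∂μ +
        c ^ 2 * (δ * K₂ * fiberMean μ q g)) :=
        ENNReal.tsum_le_tsum fun g => fiberOscillation_wordPerm_le h hinv hκ hb hq w hK₂ hδ g
    _ = K ^ 2 * (c * ∑' g, ∫⁻ x, (q ((extensionMap θ κ)^[n] (x, g)) - q (x, g)) ∂μ +
        c * ∑' g, ∫⁻ x, (q (x, g) - q ((extensionMap θ κ)^[n] (x, g))) ∂μ +
        c ^ 2 * (δ * K₂ * I)) := by
        simp only [ENNReal.tsum_mul_left, ENNReal.tsum_add, tsum_fiberMean hq, hI]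
    _ ≤ K ^ 2 * (c * (n * (η * I)) + c * (n * (η * I)) + c ^ 2 * (δ * K₂ * I)) := by gcongr
    _ = K ^ 2 * (c * (2 * n * η) * I + c ^ 2 * (δ * K₂ * I)) := by ring
    _ ≤ K ^ 2 * (c * (δ' * c) * I + c ^ 2 * (δ * K₂ * I)) := by gcongr
    _ = _ := by ring

/-- Insert `q` and `q ∘ T` between the two means. The distance from `q` to its fiber means is at
most the oscillation, by integrating the inner variable first. -/
lemma lintegral_fiberMean_sub_le (h : IsMarkovMap θ μ α) (hinv : MeasurePreserving θ μ μ)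
    (hκ : IsNearestNeighbourCocycle G α κ) {q : X × V → ℝ≥0∞} (hq : Measurable q) :
    ∫⁻ p, (fiberMean μ q p.2 - fiberMean μ q (extensionMap θ κ p).2) ∂(μ.prod Measure.count) ≤
      ∑' g, fiberOscillation μ q g +
        (∫⁻ p, (q p - q (extensionMap θ κ p)) ∂(μ.prod Measure.count) +
        ∑' g, fiberOscillation μ q g) := by
  have hT := hκ.measurePreserving_extensionMap h hinv
  have hqT := hq.comp hT.measurable
  have hQ : Measurable fun p : X × V => fiberMean μ q p.2 :=
    (Measurable.of_discrete (f := fiberMean μ q)).comp measurable_snd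
  have h1 : ∫⁻ p, (q p - fiberMean μ q p.2) ∂(μ.prod Measure.count) ≤
      ∑' g, fiberOscillation μ q g := by
    rw [lintegral_prod_count (f := fun p => q p - fiberMean μ q p.2) (hq.sub hQ)]
    refine ENNReal.tsum_le_tsum fun g => lintegral_mono fun x => ?_
    have h3 := lintegral_sub_le (μ := μ) (fun y => q (y, g)) (fun _ => q (x, g))
      (measurable_section hq g)
    rwa [lintegral_const, measure_univ, mul_one] at h3
  have h2 : ∫⁻ p, (fiberMean μ q p.2 - q p) ∂(μ.prod Measure.count) ≤
      ∑' g, fiberOscillation μ q g := by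
    rw [lintegral_prod_count (f := fun p => fiberMean μ q p.2 - q p) (hQ.sub hq)]
    refine ENNReal.tsum_le_tsum fun g => ?_
    have hqg := measurable_section hq g
    rw [fiberOscillation, lintegral_lintegral_swap]
    · refine lintegral_mono fun x => ?_
      simpa [fiberMean] using lintegral_sub_le (μ := μ) (fun _ => q (x, g)) (fun y => q (y, g))
        measurable_const
    · exact ((hqg.comp measurable_fst).sub (hqg.comp measurable_snd)).aemeasurable
  have h3 : ∫⁻ p, (q (extensionMap θ κ p) - fiberMean μ q (extensionMap θ κ p).2)
      ∂(μ.prod Measure.count) ≤ ∑' g, fiberOscillation μ q g :=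
    (hT.lintegral_comp (f := fun p => q p - fiberMean μ q p.2) (hq.sub hQ)).trans_le h1
  refine le_trans ?_ (add_le_add h2 (add_le_add le_rfl h3))
  rw [← lintegral_add_left (f := fun p => q p - q (extensionMap θ κ p)) (hq.sub hqT),
    ← lintegral_add_left (f := fun p => fiberMean μ q p.2 - q p) (hQ.sub hq)]
  exact lintegral_mono fun p => tsub_le_tsub_add_tsub.trans
    (add_le_add le_rfl tsub_le_tsub_add_tsub)

/-- Level sets of a summable function that is almost invariant under the cocycle. -/
lemma exists_escapeMass_le {Q : V → ℝ≥0∞} {T : X × V → X × V} (hT : Measurable T)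
    (hQ : ∑' g, Q g ≠ ∞) {ε : ℝ≥0∞}
    (hlt : ∫⁻ p, (Q p.2 - Q (T p).2) ∂(μ.prod Measure.count) < ε * ∑' g, Q g) :
    ∃ A : Finset V, A.Nonempty ∧ escapeMass μ T A ≤ ε * (A.card : ℝ≥0∞) := by
  have hfin : ∀ g, Q g ≠ ∞ := ENNReal.ne_top_of_tsum_ne_top hQ
  have hQm : Measurable fun p : X × V => (Q p.2).toReal :=
    (Measurable.of_discrete (f := fun g => (Q g).toReal)).comp measurable_snd
  obtain ⟨t, ht, hlt'⟩ := exists_measure_crossing_lt (m := μ.prod Measure.count) hQm (hQm.comp hT)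
    (ε := ε) (by
      simpa only [ENNReal.ofReal_sub _ ENNReal.toReal_nonneg, ENNReal.ofReal_toReal (hfin _),
        Function.comp_apply, lintegral_snd_prod_count Q] using hlt)
  -- A summable function exceeds a positive level at finitely many vertices only.
  have hA : {g | t < (Q g).toReal}.Finite := by
    refine (ENNReal.finite_const_le_of_tsum_ne_top hQ (ε := ENNReal.ofReal t)
      (ENNReal.ofReal_pos.2 ht).ne').subset fun g hg => ?_
    exact (ENNReal.ofReal_le_iff_le_toReal (hfin g)).2 (le_of_lt hg)
  have hcard : μ.prod Measure.count {p : X × V | t < (Q p.2).toReal} = hA.toFinset.card := by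
    rw [← measure_fiberSet (μ := μ)]
    congr 1
    ext p
    simp [fiberSet]
  have hesc : escapeMass μ T hA.toFinset =
      μ.prod Measure.count {p : X × V | t < (Q p.2).toReal ∧ (Q (T p).2).toReal ≤ t} := by
    rw [escapeMass]
    congr 1
    ext p
    simp [fiberSet]
  rw [hcard] at hlt'
  refine ⟨hA.toFinset, ?_, hesc.trans_le hlt'.le⟩
  -- For an empty level set the strict inequality `hlt'` would have `0` on the right.
  by_contra hne
  rw [Finset.not_nonempty_iff_eq_empty] at hne
  simp [hne] at hlt'

/-- If the averages do not contract `ℓ²` exponentially, there are Følner sets. -/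
lemma IsFullGibbsMarkov.hasFolnerSets (h : IsFullGibbsMarkov θ μ α)
    (hinv : MeasurePreserving θ μ μ) (hκ : IsNearestNeighbourCocycle G α κ) {M : ℝ≥0∞}
    (hM : M ≠ ∞)
    (H : ∀ N, ∃ U : V → ℝ≥0∞, ∑' g, U g ^ 2 ≠ 0 ∧ ∑' g, U g ^ 2 ≠ ∞ ∧
      ∑' g, U g ^ 2 ≤ M * ∑' g, averageSum θ μ α κ U (N + 1) g ^ 2) :
    HasFolnerSets μ (extensionMap θ κ) := by
  obtain ⟨C, r, hC, hr0, hr1, hd⟩ := h.exists_hasDistortion hinv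
  have hb := hd.hasBoundedDensities hC hr0 hr1 hinv
  intro ε hε
  set K := ENNReal.ofReal (Real.exp C)
  have hK : K ≠ ∞ := ENNReal.ofReal_ne_top
  set K₂ := ENNReal.ofReal (Real.exp (2 * C)) with hK₂def
  have hK₂ : K₂ ≠ ∞ := ENNReal.ofReal_ne_top
  -- Two oscillation terms and one invariance defect use three quarters of `ε`; the last quarter
  -- makes the final inequality strict.
  set e := ENNReal.ofReal (ε / 4) with he
  have he0 : e ≠ 0 := (ENNReal.ofReal_pos.2 (by positivity)).ne'
  have he2 : e / 2 ≠ 0 := (ENNReal.half_pos he0).ne'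
  obtain ⟨n, hn⟩ : ∃ n : ℕ, K ^ 2 * K₂ * ENNReal.ofReal (Real.exp (2 * C * r ^ n) - 1) < e / 2 := by
    have h1 : Tendsto (fun n : ℕ => Real.exp (2 * C * r ^ n) - 1) atTop (𝓝 0) := by
      have h2 := ((tendsto_pow_atTop_nhds_zero_of_lt_one hr0.le hr1).const_mul (2 * C))
      have h3 := (Real.continuous_exp.tendsto _).comp h2
      simpa using h3.sub_const 1
    have h4 := ENNReal.Tendsto.const_mul (a := K ^ 2 * K₂) (ENNReal.tendsto_ofReal h1)
      (Or.inr (ENNReal.mul_ne_top (ENNReal.pow_ne_top hK) hK₂))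
    rw [ENNReal.ofReal_zero, mul_zero] at h4
    exact ((tendsto_order.1 h4).2 _ (pos_iff_ne_zero.2 he2)).exists
  set δ := ENNReal.ofReal (Real.exp (2 * C * r ^ n) - 1) with hδdef
  obtain ⟨δ', hδ'0, hδ'⟩ := ENNReal.exists_nnreal_pos_mul_lt (ENNReal.pow_ne_top hK (n := 2)) he2
  obtain ⟨x₀⟩ : Nonempty X := nonempty_of_isProbabilityMeasure μ
  obtain ⟨i₀, -⟩ := h.toIsMarkovMap.exists_mem_atom x₀
  set w : Fin n → ι := fun _ => i₀
  have hw : μ (cylinder θ α w) ≠ 0 := fun h0 => by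
    have := h.absolutelyContinuous_branchMeasure hinv w
      ((branchMeasure_univ (α := α) hinv w).trans h0)
    simp at this
  have hmin : min (δ' * μ (cylinder θ α w)) e ≠ 0 := by
    refine (lt_min ?_ (pos_iff_ne_zero.2 he0)).ne'
    exact ENNReal.mul_pos (by exact_mod_cast hδ'0.ne') hw
  -- The invariance parameter is chosen last, after the length `n` and the word `w`. With `η = 3 t`,
  -- the conditions are `2 n η ≤ δ' μ[w]` and `η ≤ e`, both implied by the factor `6 n + 3`.
  obtain ⟨t, ht0, ht⟩ := ENNReal.exists_nnreal_pos_mul_lt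
    (a := 6 * n + 3) (by finiteness) hmin
  obtain ⟨q, hq, hq0, hqfin, h1, h2, hqd⟩ := exists_almost_invariant_density h.toIsMarkovMap hinv hκ
    hK hb hd hM H (s := t⁻¹) (inv_ne_zero ht0.ne')
  rw [inv_inv] at h1 h2
  set I := ∫⁻ p, q p ∂(μ.prod Measure.count) with hI
  have hηe : 3 * (t : ℝ≥0∞) ≤ e := by
    refine le_trans ?_ (ht.le.trans (min_le_right _ _))
    rw [mul_comm]
    gcongr
    exact le_add_self
  have hηc : 2 * n * (3 * (t : ℝ≥0∞)) ≤ δ' * μ (cylinder θ α w) := by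
    refine le_trans ?_ (ht.le.trans (min_le_left _ _))
    calc 2 * n * (3 * (t : ℝ≥0∞)) = t * (6 * n) := by ring
      _ ≤ _ := by gcongr; exact le_self_add
  have hqK₂ : ∀ᵐ x ∂μ, ∀ᵐ y ∂μ, ∀ g, q (x, g) ≤ K₂ * q (y, g) := by
    filter_upwards [hqd] with x hx
    filter_upwards [hx] with y hy g
    refine (hy g).trans (mul_le_mul_left (ENNReal.ofReal_le_ofReal (Real.exp_le_exp.2 ?_)) _)
    nlinarith [symbolicDist_le_one (θ := θ) (α := α) hr0 hr1 x y]
  have hqδ : ∀ᵐ x ∂μ, ∀ᵐ y ∂μ, ∀ g, x ∈ cylinder θ α w → y ∈ cylinder θ α w →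
      q (x, g) ≤ (1 + δ) * q (y, g) := by
    filter_upwards [hqd] with x hx
    filter_upwards [hx] with y hy g hxw hyw
    refine (hy g).trans (mul_le_mul_left ?_ _)
    have h5 : 0 ≤ Real.exp (2 * C * r ^ n) - 1 :=
      sub_nonneg.2 (Real.one_le_exp (by positivity))
    rw [hδdef, ← ENNReal.ofReal_one, ← ENNReal.ofReal_add zero_le_one h5, add_sub_cancel]
    refine ENNReal.ofReal_le_ofReal (Real.exp_le_exp.2 ?_)
    exact mul_le_mul_of_nonneg_left (symbolicDist_le_of_mem_cylinder hr0 hr1 hxw hyw)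
      (by positivity)
  have hosc : ∑' g, fiberOscillation μ q g ≤ e * I := by
    refine (tsum_fiberOscillation_le h.toIsMarkovMap hinv hκ hb hq hw hqK₂ hqδ h1 h2 hηc).trans ?_
    gcongr
    calc K ^ 2 * (δ' + δ * K₂) = δ' * K ^ 2 + K ^ 2 * K₂ * δ := by ring
      _ ≤ e / 2 + e / 2 := add_le_add hδ'.le hn.le
      _ = e := ENNReal.add_halves e
  have hQ : ∑' g, fiberMean μ q g = I := tsum_fiberMean hq
  refine exists_escapeMass_le (Q := fiberMean μ q)
    (hκ.measurable_extensionMap h.toIsMarkovMap hinv.measurable) (by rwa [hQ]) ?_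
  rw [hQ]
  calc _ ≤ e * I + (e * I + e * I) :=
        (lintegral_fiberMean_sub_le h.toIsMarkovMap hinv hκ hq).trans
          (add_le_add hosc (add_le_add (h2.trans (mul_le_mul_left hηe _)) hosc))
    _ < e * I + (e * I + e * I) + e * I := by
        refine ENNReal.lt_add_right ?_ (mul_ne_zero he0 hq0)
        have : e * I ≠ ∞ := ENNReal.mul_ne_top ENNReal.ofReal_ne_top hqfin
        finiteness
    _ = 4 * e * I := by ring
    _ = _ := by
        rw [he, ← ENNReal.ofReal_ofNat, ← ENNReal.ofReal_mul (by norm_num),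
          mul_div_cancel₀ _ four_ne_zero]

end Oscillation

/-! ### Spectral radius one and Følner sets -/

section Main

variable {X ι V : Type*} [MeasurableSpace X] {θ : X → X} {μ : Measure X} {α : ι → Set X}
  {κ : X → Equiv.Perm V} [IsProbabilityMeasure μ] [MeasurableSpace V] [Countable V]
  [DiscreteMeasurableSpace V] [Countable ι] {G : Digraph V}

lemma enorm_sq_eq_tsum (f : HInfty μ V) : ‖f‖ₑ ^ 2 = ∑' g, ‖f g‖ₑ ^ 2 := by
  rw [← ofReal_norm, ← ENNReal.ofReal_pow (norm_nonneg _), norm_sq_eq_tsum,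
    ENNReal.ofReal_tsum_of_nonneg (fun _ => by positivity) (summable_norm_sq f)]
  simp only [ENNReal.ofReal_pow (norm_nonneg _), ofReal_norm]

lemma IsFullGibbsMarkov.hasFolnerSets_of_spectralRadius (h : IsFullGibbsMarkov θ μ α)
    (hinv : MeasurePreserving θ μ μ) (hκ : IsNearestNeighbourCocycle G α κ)
    {L : HInfty μ V →L[ℂ] HInfty μ V} (hL : IsTransferOperator (extensionMap θ κ) L)
    (hρ : spectralRadius ℂ L = 1) : HasFolnerSets μ (extensionMap θ κ) := by
  obtain ⟨C, r, hC, hr0, hr1, hd⟩ := h.exists_hasDistortion hinv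
  have hb := hd.hasBoundedDensities hC hr0 hr1 hinv
  set K := ENNReal.ofReal (Real.exp C)
  have hK : K ≠ ∞ := ENNReal.ofReal_ne_top
  have hT := hκ.measurePreserving_extensionMap h.toIsMarkovMap hinv
  -- Take `U g = ‖f g‖` for an `f` that loses at most half of its norm under the power `N + 1`. The
  -- half gives the `4`, the fiberwise bound of the iterate by `K` times the average gives `K ^ 2`.
  refine h.hasFolnerSets hinv hκ (M := 4 * K ^ 2) (by finiteness) fun N => ?_
  obtain ⟨f, hf⟩ := exists_half_norm_lt_of_spectralRadius_eq_one hρ N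
  obtain ⟨L', hL', -, hbound⟩ := h.exists_isTransferOperator_iterate hinv hκ hK hb (N + 1)
  rw [(hL.pow hT (N + 1)).unique hL'] at hf
  refine ⟨fun g => ‖f g‖ₑ, ?_, ?_, ?_⟩
  · rw [← enorm_sq_eq_tsum]
    refine pow_ne_zero 2 fun h0 => ?_
    rw [enorm_eq_zero] at h0
    simp [h0] at hf
  · rw [← enorm_sq_eq_tsum]
    exact ENNReal.pow_ne_top enorm_ne_top
  · have h1 : ‖f‖ₑ ≤ 2 * ‖L' f‖ₑ := by
      rw [← ofReal_norm, ← ofReal_norm, two_mul,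
        ← ENNReal.ofReal_add (norm_nonneg _) (norm_nonneg _)]
      exact ENNReal.ofReal_le_ofReal (by linarith)
    rw [← enorm_sq_eq_tsum]
    calc ‖f‖ₑ ^ 2 ≤ (2 * ‖L' f‖ₑ) ^ 2 := by gcongr
      _ = 4 * ∑' g, ‖L' f g‖ₑ ^ 2 := by
          rw [mul_pow, enorm_sq_eq_tsum (L' f)]
          norm_num
      _ ≤ 4 * ∑' g, K ^ 2 * averageSum θ μ α κ (fun g => ‖f g‖ₑ) (N + 1) g ^ 2 := by
          refine mul_le_mul_right (ENNReal.tsum_le_tsum fun g => ?_) _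
          rw [← mul_pow]
          exact pow_le_pow_left' (hbound f g) 2
      _ = _ := by rw [ENNReal.tsum_mul_left, mul_assoc]

/-- All powers have norm between `1` (Følner sets) and the distortion constant, so Gelfand's formula
applies. -/
lemma IsFullGibbsMarkov.spectralRadius_eq_one (h : IsFullGibbsMarkov θ μ α)
    (hinv : MeasurePreserving θ μ μ) (hκ : IsNearestNeighbourCocycle G α κ)
    {L : HInfty μ V →L[ℂ] HInfty μ V} (hL : IsTransferOperator (extensionMap θ κ) L)
    (hF : HasFolnerSets μ (extensionMap θ κ)) : spectralRadius ℂ L = 1 := by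
  obtain ⟨C, r, hC, hr0, hr1, hd⟩ := h.exists_hasDistortion hinv
  have hb := hd.hasBoundedDensities hC hr0 hr1 hinv
  have hT := hκ.measurePreserving_extensionMap h.toIsMarkovMap hinv
  refine spectralRadius_eq_one_of_norm_pow_bounded
    (K := (ENNReal.ofReal (Real.exp C)).toReal) (hF.one_le_norm_pow hT hL) fun n => ?_
  obtain ⟨L', hL', hnorm, -⟩ :=
    h.exists_isTransferOperator_iterate hinv hκ ENNReal.ofReal_ne_top hb n
  rw [(hL.pow hT n).unique hL']
  exact hnorm

end Main

end GraphExtension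

end

open GraphExtension in
theorem theoremA {X : Type*} [MeasurableSpace X] [StandardBorelSpace X]
    {ι : Type*} [Countable ι]
    {V : Type*} [Countable V] [Nonempty V] [MeasurableSpace V] [DiscreteMeasurableSpace V]
    (θ : X → X) (μ : Measure X) [IsProbabilityMeasure μ] (α : ι → Set X)
    (hGM : IsFullGibbsMarkov θ μ α) (hinv : MeasurePreserving θ μ μ)
    (G : Digraph V) (κ : X → Equiv.Perm V) (hκ : IsNearestNeighbourCocycle G α κ)
    (htrans : IsTopologicallyTransitive μ α (extensionMap θ κ))
    (hloops : ∃ n : ℕ, 0 < n ∧ HasUniformLoops (extensionMap θ κ)^[n]) :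
    (∃! L : HInfty μ V →L[ℂ] HInfty μ V, IsTransferOperator (extensionMap θ κ) L) ∧
    ∀ L : HInfty μ V →L[ℂ] HInfty μ V, IsTransferOperator (extensionMap θ κ) L →
      List.TFAE [
        IsMuAmenable G μ κ,
        spectralRadius ℂ L = 1,
        ∀ ε : ℝ, 0 < ε → ∃ A : Finset V, A.Nonempty ∧
          ∫⁻ p, ‖toFun (L (fiberIndicator μ A)) p - toFun (fiberIndicator μ A) p‖ₑ
            ∂(μ.prod Measure.count) ≤ ENNReal.ofReal ε * (A.card : ℝ≥0∞),
        ∀ ε : ℝ, 0 < ε → ∃ A : Finset V, A.Nonempty ∧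
          norm1 (L (fiberIndicator μ A) - fiberIndicator μ A) ≤
            ENNReal.ofReal ε * norm1 (fiberIndicator μ A)] := by
  have hM := hGM.toIsMarkovMap
  constructor
  · obtain ⟨C, r, hC, hr0, hr1, hd⟩ := hGM.exists_hasDistortion hinv
    -- Existence is the case of the first iterate.
    obtain ⟨L, hL, -⟩ := hGM.exists_isTransferOperator_iterate hinv hκ ENNReal.ofReal_ne_top
      (hd.hasBoundedDensities hC hr0 hr1 hinv) 1
    exact ⟨L, hL, fun L' hL' => IsTransferOperator.unique hL' hL⟩
  · intro L hL
    have h1 : IsMuAmenable G μ κ ↔ HasFolnerSets μ (extensionMap θ κ) :=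
      ⟨fun ha => ha.hasFolnerSets hκ hM hinv.measurable,
        fun hF => hF.isMuAmenable hκ hM hinv.measurable⟩
    have h2 : spectralRadius ℂ L = 1 ↔ HasFolnerSets μ (extensionMap θ κ) :=
      ⟨hGM.hasFolnerSets_of_spectralRadius hinv hκ hL, hGM.spectralRadius_eq_one hinv hκ hL⟩
    tfae_have 1 ↔ 2 := h1.trans h2.symm
    tfae_have 1 ↔ 3 := h1.trans (hasFolnerSets_iff_lintegral hκ hM hinv hL)
    tfae_have 1 ↔ 4 := h1.trans (hasFolnerSets_iff_norm1 hκ hM hinv hL)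
    tfae_finish
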